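/- Let $\beta>0$ and let $\nu$ be a Borel probability measure on $\mathbb R$ with $\int_{\mathbb R} h^2\,d\nu(h)<\infty$. Let $\mathbf h=(h_i)_{i\ge 1}$ have law $\mu=\nu^{\otimes\mathbb N}$, i.e. the $h_i$ are i.i.d. with law $\nu$. For $n\ge1$ let $P_{n,\beta}^{\mathbf h}$ be the Gibbs measure of the random-field Curie–Weiss model on $\{-1,+1\}^n$, $$P_{n,\beta}^{\mathbf h}(\sigma)=\frac{1}{Z_{n,\beta}^{\mathbf h}}\exp\Big(\frac{\beta}{2n}\Big[\sum_{i=1}^n\sigma_i\Big]^2+\beta\sum_{i=1}^n h_i\sigma_i\Big),$$ where $Z_{n,\beta}^{\mathbf h}$ is the normalizing constant, and let $S_n=\sum_{i=1}^n\sigma_i$. Put $$G(x)=\frac{\beta}{2}x^2-\int_{\mathbb R}\ln\cosh[\beta(x+h)]\,d\nu(h),\qquad x\in\mathbb R.$$ Suppose that $G$ has a unique global minimum point $m$, and that $m$ is of type $k\in\{1,2,\dots\}$ and strength $\lambda>0$, i.e. $$G(x)=G(m)+\frac{\lambda}{(2k)!}(x-m)^{2k}+\mathcal O\big((x-m)^{2k+1}\big)\quad\text{as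 }x\to m.$$ Then, for $\mu$-almost every realization of $\mathbf h$, the following holds for every $\alpha$ with $1-\frac{1}{2(2k-1)}<\alpha<1$: the laws $\rho_n$ of $(S_n-nm)/n^{\alpha}$ under $P_{n,\beta}^{\mathbf h}$, $n\ge1$, satisfy a moderate deviations principle with speed $a_n=n^{1-2k(1-\alpha)}$ and rate function $$I(x)=\begin{cases}\dfrac{x^2}{2(\lambda^{-1}-\beta^{-1})},& k=1,\\[2mm] \dfrac{\lambda x^{2k}}{(2k)!},& k\ge2,\end{cases}$$ that is, $I$ is lower semicontinuous with compact level sets $\{I\le c\}$, $c\in\mathbb R$, and for every Borel set $C\subseteq\mathbb R$ $$-\inf_{x\in C^\circ}I(x)\le\liminf_{n\to\infty}\frac1{a_n}\ln\rho_n(C)\le\limsup_{n\to\infty}\frac1{a_n}\ln\rho_n(C)\le-\inf_{x\in\overline C}I(x),$$ with the conventions $\ln 0=-\infty$ and $\inf\emptyset=+\infty$. -/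

import Mathlib

open MeasureTheory Filter Topology Asymptotics

noncomputable section

namespace RFCW

/-- Total magnetization `S_n(σ) = ∑ σ_i` of a configuration `σ ∈ {-1,+1}^n`; the spin space
`{-1,+1}` is the group of units of `ℤ`. -/
def magnetization {n : ℕ} (σ : Fin n → ℤˣ) : ℝ :=
  ∑ i, ((σ i : ℤ) : ℝ)

/-- The Hamiltonian of the random field Curie-Weiss model with field `h`. -/
def hamiltonian (h : ℕ → ℝ) {n : ℕ} (σ : Fin n → ℤˣ) : ℝ :=
  -(1 / (2 * (n : ℝ))) * ∑ i, ∑ j, ((σ i : ℤ) : ℝ) * ((σ j : ℤ) : ℝ)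
    - ∑ i : Fin n, h i * ((σ i : ℤ) : ℝ)

/-- The partition function at inverse temperature `β`. -/
def partitionFunction (β : ℝ) (h : ℕ → ℝ) (n : ℕ) : ℝ :=
  ∑ σ : Fin n → ℤˣ, Real.exp (-β * hamiltonian h σ)

/-- The Gibbs measure on `{-1,+1}^n` at inverse temperature `β` for the field `h`. -/
def gibbsMeasure (β : ℝ) (h : ℕ → ℝ) (n : ℕ) : Measure (Fin n → ℤˣ) :=
  ∑ σ : Fin n → ℤˣ,
    ENNReal.ofReal (Real.exp (-β * hamiltonian h σ) / partitionFunction β h n) •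
      Measure.dirac σ

/-- The law of `(S_n - n m) / n^α` under the Gibbs measure. -/
def scaledMagnetizationLaw (β : ℝ) (h : ℕ → ℝ) (m α : ℝ) (n : ℕ) : Measure ℝ :=
  (gibbsMeasure β h n).map fun σ => (magnetization σ - n * m) / (n : ℝ) ^ α

/-- The function `G(x) = β x² / 2 - ∫ log cosh (β (x + h)) dν(h)`. -/
def G (β : ℝ) (ν : Measure ℝ) (x : ℝ) : ℝ :=
  β / 2 * x ^ 2 - ∫ h, Real.log (Real.cosh (β * (x + h))) ∂ν

/-- `ν` is pure and centered at `m`: the set of global minimizers of `G` is `{m}`. -/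
def IsPureCenteredAt (β : ℝ) (ν : Measure ℝ) (m : ℝ) : Prop :=
  {x : ℝ | IsMinOn (G β ν) Set.univ x} = {m}

/-- `m` is of type `k ∈ {1, 2, …}` and strength `lam > 0`. -/
structure HasTypeStrength (β : ℝ) (ν : Measure ℝ) (m : ℝ) (k : ℕ) (lam : ℝ) : Prop where
  one_le_type : 1 ≤ k
  strength_pos : 0 < lam
  expansion :
    (fun x : ℝ => G β ν x - (G β ν m + lam / ((2 * k).factorial : ℝ) * (x - m) ^ (2 * k)))
      =O[𝓝 m] fun x : ℝ => (x - m) ^ (2 * k + 1)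

/-- The sequence `P` of measures on `ℝ` satisfies a large (or moderate) deviations principle with
speed `a` and good rate function `I`. Logarithms, limits and infima are taken in `[-∞, ∞]`, so
that `log 0 = -∞` and the infimum over the empty set is `+∞`. -/
structure SatisfiesLDP (P : ℕ → Measure ℝ) (a : ℕ → ℝ) (I : ℝ → EReal) : Prop where
  lowerSemicontinuous : LowerSemicontinuous I
  isCompact_level : ∀ c : ℝ, IsCompact {x : ℝ | I x ≤ (c : EReal)}
  lower_bound : ∀ C : Set ℝ, MeasurableSet C →
    -(⨅ x ∈ interior C, I x) ≤
      liminf (fun n : ℕ => ENNReal.log (P n C) / ((a n : ℝ) : EReal)) atTop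
  upper_bound : ∀ C : Set ℝ, MeasurableSet C →
    limsup (fun n : ℕ => ENNReal.log (P n C) / ((a n : ℝ) : EReal)) atTop ≤
      -(⨅ x ∈ closure C, I x)

/-- The rate function: `x² / (2 σ²)` with `σ² = lam⁻¹ - β⁻¹` if `k = 1`, and
`lam x^{2k} / (2k)!` otherwise. -/
def rateFunction (β : ℝ) (k : ℕ) (lam x : ℝ) : ℝ :=
  if k = 1 then x ^ 2 / (2 * (lam⁻¹ - β⁻¹))
  else lam * x ^ (2 * k) / ((2 * k).factorial : ℝ)

end RFCW

end

/-!
Writing `e^{β S²/(2n)}` around an external field `x` turns the Gibbs weight of a configuration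
with magnetization `S = n u` into `e^{nβ(u - x)²/2}` times the weight of independent spins in the
fields `β (x + hᵢ)`, whose total mass is `e^{-n Gₙ(x)}` for the empirical version `Gₙ` of `G`.
Taking `x = u` would give the exponent `G`, but `G` is not the rate function when `k = 1`: the
best choice near the minimum `m` is `x = m + c (u - m)`, where `c⁻¹ = 1 - G''(m)/β` is the
susceptibility of the independent spins. With this field the upper bound is a union bound over the
values of `S`, and the lower bound holds because the independent spins concentrate around `n u`.
The disorder enters only through `Gₙ' - G'`, an average of independent centred copies of
`tanh (β (x + h))`, which is `O(n^{-1/2+ε})` almost surely, uniformly for bounded `x`; the condition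
on `α` makes this negligible against `G'` on the scale `|x - m| = n^{α-1}`.
-/

namespace RFCW

section Hyperbolic

lemma hasDerivAt_log_cosh (x : ℝ) :
    HasDerivAt (fun y => Real.log (Real.cosh y)) (Real.tanh x) x := by
  rw [Real.tanh_eq_sinh_div_cosh]
  exact (Real.hasDerivAt_cosh x).log (Real.cosh_pos x).ne'

lemma hasDerivAt_tanh (x : ℝ) : HasDerivAt Real.tanh (1 / Real.cosh x ^ 2) x := by
  have h := (Real.hasDerivAt_sinh x).div (Real.hasDerivAt_cosh x) (Real.cosh_pos x).ne'
  rw [← sq, ← sq, Real.cosh_sq_sub_sinh_sq] at h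
  exact h.congr_of_eventuallyEq (.of_forall Real.tanh_eq_sinh_div_cosh)

lemma one_div_cosh_sq_pos (x : ℝ) : 0 < 1 / Real.cosh x ^ 2 :=
  one_div_pos.2 (pow_pos (Real.cosh_pos x) 2)

lemma abs_one_div_cosh_sq_le_one (x : ℝ) : |1 / Real.cosh x ^ 2| ≤ 1 := by
  rw [abs_of_pos (one_div_cosh_sq_pos x), div_le_one (pow_pos (Real.cosh_pos x) 2)]
  exact one_le_pow₀ (Real.one_le_cosh x)

lemma continuous_tanh : Continuous Real.tanh :=
  continuous_iff_continuousAt.2 fun x => (hasDerivAt_tanh x).continuousAt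

lemma continuous_one_div_cosh_sq : Continuous fun x : ℝ => 1 / Real.cosh x ^ 2 :=
  continuous_const.div (Real.continuous_cosh.pow 2) fun x => (pow_pos (Real.cosh_pos x) 2).ne'

lemma abs_tanh_sub_tanh_le (x y : ℝ) : |Real.tanh x - Real.tanh y| ≤ |x - y| := by
  simpa using convex_univ.norm_image_sub_le_of_norm_hasDerivWithin_le
    (fun z _ => (hasDerivAt_tanh z).hasDerivWithinAt)
    (fun z _ => abs_one_div_cosh_sq_le_one z) (Set.mem_univ y) (Set.mem_univ x)

lemma abs_log_cosh_le_abs (x : ℝ) : |Real.log (Real.cosh x)| ≤ |x| := by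
  simpa using convex_univ.norm_image_sub_le_of_norm_hasDerivWithin_le
    (fun z _ => (hasDerivAt_log_cosh z).hasDerivWithinAt)
    (fun z _ => (Real.abs_tanh_lt_one z).le) (Set.mem_univ 0) (Set.mem_univ x)

lemma log_cosh_add_le_of_nonneg (y : ℝ) {t : ℝ} (ht : 0 ≤ t) :
    Real.log (Real.cosh (y + t)) ≤ Real.log (Real.cosh y) + t * Real.tanh y + t ^ 2 / 2 := by
  set f : ℝ → ℝ := fun s => s ^ 2 / 2 + s * Real.tanh y - Real.log (Real.cosh (y + s)) with hf
  have hderiv (s : ℝ) : HasDerivAt f (s + Real.tanh y - Real.tanh (y + s)) s := by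
    have hquad := ((hasDerivAt_pow 2 s).div_const 2).add
      ((hasDerivAt_id s).mul_const (Real.tanh y))
    refine (hquad.sub ((hasDerivAt_log_cosh (y + s)).comp_const_add y s)).congr_deriv ?_
    simp
  have hmono : MonotoneOn f (Set.Ici 0) := by
    refine monotoneOn_of_hasDerivWithinAt_nonneg (convex_Ici 0)
      (fun s _ => (hderiv s).continuousAt.continuousWithinAt)
      (fun s _ => (hderiv s).hasDerivWithinAt) fun s hs => ?_
    rw [interior_Ici, Set.mem_Ioi] at hs
    have hlip := (le_abs_self _).trans (abs_tanh_sub_tanh_le (y + s) y)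
    rw [add_sub_cancel_left, abs_of_pos hs] at hlip
    linarith
  have hle : f 0 ≤ f t := hmono Set.self_mem_Ici ht ht
  simp only [hf, add_zero] at hle
  linarith

lemma log_cosh_add_le (y t : ℝ) :
    Real.log (Real.cosh (y + t)) ≤ Real.log (Real.cosh y) + t * Real.tanh y + t ^ 2 / 2 := by
  rcases le_total 0 t with ht | ht
  · exact log_cosh_add_le_of_nonneg y ht
  · have hneg := log_cosh_add_le_of_nonneg (-y) (neg_nonneg.2 ht)
    rw [← neg_add, Real.cosh_neg, Real.cosh_neg, Real.tanh_neg] at hneg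
    linarith

lemma log_two_mul_cosh (y : ℝ) :
    Real.log (2 * Real.cosh y) = Real.log 2 + Real.log (Real.cosh y) :=
  Real.log_mul two_ne_zero (Real.cosh_pos y).ne'

end Hyperbolic

section IndependentSpins

variable {n : ℕ}

/-- The weight `exp (∑ bᵢ σᵢ)` of a configuration of independent spins in the fields `bᵢ`, against
which the Gibbs weights are compared. -/
noncomputable def fieldWeight (b : Fin n → ℝ) (σ : Fin n → ℤˣ) : ℝ :=
  Real.exp (∑ i, b i * ((σ i : ℤ) : ℝ))

lemma fieldWeight_pos (b : Fin n → ℝ) (σ : Fin n → ℤˣ) : 0 < fieldWeight b σ :=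
  Real.exp_pos _

lemma fieldWeight_add_const (b : Fin n → ℝ) (t : ℝ) (σ : Fin n → ℤˣ) :
    fieldWeight (fun i => b i + t) σ = fieldWeight b σ * Real.exp (t * magnetization σ) := by
  simp only [fieldWeight, magnetization, ← Real.exp_add, Finset.mul_sum, ← Finset.sum_add_distrib,
    add_mul]

lemma sum_exp_mul_spin (b : ℝ) :
    ∑ s : ℤˣ, Real.exp (b * ((s : ℤ) : ℝ)) = 2 * Real.cosh b := by
  rw [Real.cosh_eq, show (Finset.univ : Finset ℤˣ) = {1, -1} from rfl,
    Finset.sum_pair (by decide)]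
  push_cast
  ring_nf

lemma sum_fieldWeight (b : Fin n → ℝ) :
    ∑ σ, fieldWeight b σ = Real.exp (∑ i, Real.log (2 * Real.cosh (b i))) := by
  have hpos (i : Fin n) : 0 < 2 * Real.cosh (b i) := mul_pos two_pos (Real.cosh_pos _)
  simp_rw [fieldWeight, Real.exp_sum, Real.exp_log (hpos _), ← sum_exp_mul_spin]
  exact (Fintype.prod_sum fun i (s : ℤˣ) => Real.exp (b i * ((s : ℤ) : ℝ))).symm

lemma sum_log_two_mul_cosh_add_le (b : Fin n → ℝ) (t : ℝ) :
    ∑ i, Real.log (2 * Real.cosh (b i + t)) ≤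
      ∑ i, Real.log (2 * Real.cosh (b i)) + t * ∑ i, Real.tanh (b i) + n * t ^ 2 / 2 := by
  calc ∑ i, Real.log (2 * Real.cosh (b i + t))
      ≤ ∑ i, (Real.log (2 * Real.cosh (b i)) + t * Real.tanh (b i) + t ^ 2 / 2) := by
        refine Finset.sum_le_sum fun i _ => ?_
        rw [log_two_mul_cosh, log_two_mul_cosh]
        linarith [log_cosh_add_le (b i) t]
    _ = _ := by
        rw [Finset.sum_add_distrib, Finset.sum_add_distrib, ← Finset.mul_sum, Finset.sum_const,
          Finset.card_univ, Fintype.card_fin, nsmul_eq_mul, mul_div_assoc]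

lemma sum_fieldWeight_le_of_deviation (b : Fin n → ℝ) (t : ℝ) (A : Finset (Fin n → ℤˣ))
    (hA : ∀ σ ∈ A, n * t ^ 2 ≤ t * (magnetization σ - ∑ i, Real.tanh (b i))) :
    ∑ σ ∈ A, fieldWeight b σ ≤
      Real.exp (∑ i, Real.log (2 * Real.cosh (b i))) * Real.exp (-(n * t ^ 2 / 2)) := by
  set E := Real.exp (-(n * t ^ 2) - t * ∑ i, Real.tanh (b i)) with hE
  calc ∑ σ ∈ A, fieldWeight b σ
      ≤ ∑ σ ∈ A, E * fieldWeight (fun i => b i + t) σ := by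
        refine Finset.sum_le_sum fun σ hσ => ?_
        rw [fieldWeight_add_const, mul_left_comm, hE, ← Real.exp_add]
        refine le_mul_of_one_le_right (fieldWeight_pos b σ).le (Real.one_le_exp ?_)
        linarith [hA σ hσ]
    _ ≤ ∑ σ, E * fieldWeight (fun i => b i + t) σ :=
        Finset.sum_le_sum_of_subset_of_nonneg (Finset.subset_univ _)
          fun σ _ _ => mul_nonneg (Real.exp_pos _).le (fieldWeight_pos _ σ).le
    _ ≤ _ := by
        rw [← Finset.mul_sum, sum_fieldWeight, hE, ← Real.exp_add, ← Real.exp_add, Real.exp_le_exp]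
        linarith [sum_log_two_mul_cosh_add_le b t]

lemma le_sum_fieldWeight_of_concentration (b : Fin n → ℝ) {r : ℝ} (hr : 0 ≤ r) :
    Real.exp (∑ i, Real.log (2 * Real.cosh (b i))) * (1 - 2 * Real.exp (-(n * r ^ 2 / 2))) ≤
      ∑ σ with |magnetization σ - ∑ i, Real.tanh (b i)| < n * r, fieldWeight b σ := by
  set D : (Fin n → ℤˣ) → ℝ := fun σ => magnetization σ - ∑ i, Real.tanh (b i)
  have hupper := sum_fieldWeight_le_of_deviation b r {σ | n * r ≤ D σ} fun σ hσ => by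
    nlinarith [(Finset.mem_filter.1 hσ).2]
  have hlower := sum_fieldWeight_le_of_deviation b (-r) {σ | D σ ≤ -(n * r)} fun σ hσ => by
    nlinarith [(Finset.mem_filter.1 hσ).2]
  have hcompl : ∑ σ with ¬|D σ| < n * r, fieldWeight b σ ≤
      ∑ σ with n * r ≤ D σ, fieldWeight b σ + ∑ σ with D σ ≤ -(n * r), fieldWeight b σ := by
    simp only [Finset.sum_filter, ← Finset.sum_add_distrib]
    refine Finset.sum_le_sum fun σ _ => ?_
    have := fieldWeight_pos b σ
    split_ifs <;> grind
  have hsplit := Finset.sum_filter_add_sum_filter_not Finset.univ (fun σ => |D σ| < n * r)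
    (fieldWeight b)
  rw [sum_fieldWeight] at hsplit
  rw [neg_sq] at hlower
  linarith

end IndependentSpins

section GibbsWeights

variable {n : ℕ} {β : ℝ} {h : ℕ → ℝ}

/-- The unnormalized Gibbs weight `exp (-β H(σ))` of a configuration. -/
noncomputable def gibbsWeight (β : ℝ) (h : ℕ → ℝ) (σ : Fin n → ℤˣ) : ℝ :=
  Real.exp (-β * hamiltonian h σ)

/-- The empirical counterpart of `n G`: the average over the field is a sum over the sites. The
additive constant is chosen so that `exp (-empiricalG)` is the mass of the independent spins, whence
`2 cosh` in place of `cosh`. -/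
noncomputable def empiricalG (β : ℝ) (h : ℕ → ℝ) (n : ℕ) (x : ℝ) : ℝ :=
  n * (β / 2 * x ^ 2) - ∑ i ∈ Finset.range n, Real.log (2 * Real.cosh (β * (x + h i)))

lemma gibbsWeight_pos (β : ℝ) (h : ℕ → ℝ) (σ : Fin n → ℤˣ) : 0 < gibbsWeight β h σ :=
  Real.exp_pos _

lemma partitionFunction_pos (β : ℝ) (h : ℕ → ℝ) (n : ℕ) : 0 < partitionFunction β h n :=
  Finset.sum_pos (fun σ _ => gibbsWeight_pos β h σ) Finset.univ_nonempty

lemma abs_magnetization_le (σ : Fin n → ℤˣ) : |magnetization σ| ≤ n := by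
  refine (Finset.abs_sum_le_sum_abs _ _).trans (le_of_eq ?_)
  simp [← Int.cast_abs, Int.isUnit_iff_abs_eq.1 (Units.isUnit _)]

lemma card_image_magnetization_le (A : Finset (Fin n → ℤˣ)) :
    (A.image magnetization).card ≤ 2 * n + 1 := by
  have hsub : A.image magnetization ⊆ (Finset.Icc (-n : ℤ) n).image ((↑) : ℤ → ℝ) := by
    simp only [Finset.subset_iff, Finset.mem_image, Finset.mem_Icc, forall_exists_index, and_imp]
    rintro _ σ - rfl
    have hcast : ((∑ i, (σ i : ℤ) : ℤ) : ℝ) = magnetization σ := Int.cast_sum _ _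
    have habs := abs_le.1 (abs_magnetization_le σ)
    rw [← hcast] at habs
    exact ⟨_, ⟨by exact_mod_cast habs.1, by exact_mod_cast habs.2⟩, hcast⟩
  refine (Finset.card_le_card hsub).trans (Finset.card_image_le.trans (le_of_eq ?_))
  rw [Int.card_Icc]
  omega

lemma gibbsWeight_eq (hn : n ≠ 0) (x : ℝ) (σ : Fin n → ℤˣ) :
    gibbsWeight β h σ = Real.exp (n * (β / 2 * (magnetization σ / n - x) ^ 2)) *
      (Real.exp (-(n * (β / 2 * x ^ 2))) * fieldWeight (fun i => β * (x + h i)) σ) := by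
  have hn' : (n : ℝ) ≠ 0 := Nat.cast_ne_zero.2 hn
  have hpair : ∑ i, ∑ j, ((σ i : ℤ) : ℝ) * ((σ j : ℤ) : ℝ) = magnetization σ ^ 2 := by
    rw [sq, magnetization, Finset.sum_mul_sum]
  have hlin : ∑ i : Fin n, β * (x + h i) * ((σ i : ℤ) : ℝ) =
      β * x * magnetization σ + β * ∑ i : Fin n, h i * ((σ i : ℤ) : ℝ) := by
    rw [magnetization, Finset.mul_sum, Finset.mul_sum, ← Finset.sum_add_distrib]
    exact Finset.sum_congr rfl fun i _ => by ring
  rw [gibbsWeight, hamiltonian, fieldWeight, hpair, hlin, ← Real.exp_add, ← Real.exp_add]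
  congr 1
  field_simp
  ring

lemma exp_mul_exp_sum_log_eq_exp_neg_empiricalG (β : ℝ) (h : ℕ → ℝ) (n : ℕ) (x : ℝ) :
    Real.exp (-(n * (β / 2 * x ^ 2))) *
        Real.exp (∑ i : Fin n, Real.log (2 * Real.cosh (β * (x + h i)))) =
      Real.exp (-empiricalG β h n x) := by
  rw [← Real.exp_add, empiricalG,
    Fin.sum_univ_eq_sum_range fun i => Real.log (2 * Real.cosh (β * (x + h i)))]
  congr 1
  ring

lemma exp_mul_sum_fieldWeight (β : ℝ) (h : ℕ → ℝ) (n : ℕ) (x : ℝ) :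
    Real.exp (-(n * (β / 2 * x ^ 2))) * ∑ σ, fieldWeight (fun i : Fin n => β * (x + h i)) σ =
      Real.exp (-empiricalG β h n x) := by
  rw [sum_fieldWeight, exp_mul_exp_sum_log_eq_exp_neg_empiricalG]

lemma exp_neg_empiricalG_le_partitionFunction (hβ : 0 ≤ β) (hn : n ≠ 0) (x : ℝ) :
    Real.exp (-empiricalG β h n x) ≤ partitionFunction β h n := by
  rw [← exp_mul_sum_fieldWeight, Finset.mul_sum]
  refine Finset.sum_le_sum fun σ _ => ?_
  change _ ≤ gibbsWeight β h σ
  rw [gibbsWeight_eq hn x σ]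
  exact le_mul_of_one_le_left (mul_nonneg (Real.exp_pos _).le (fieldWeight_pos _ σ).le)
    (Real.one_le_exp (by positivity))

lemma sum_gibbsWeight_le_of_magnetization_eq (hn : n ≠ 0) (A : Finset (Fin n → ℤˣ)) {u : ℝ}
    (hA : ∀ σ ∈ A, magnetization σ = n * u) (x : ℝ) :
    ∑ σ ∈ A, gibbsWeight β h σ ≤
      Real.exp (n * (β / 2 * (u - x) ^ 2) - empiricalG β h n x) := by
  have hn' : (n : ℝ) ≠ 0 := Nat.cast_ne_zero.2 hn
  calc ∑ σ ∈ A, gibbsWeight β h σ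
      = Real.exp (n * (β / 2 * (u - x) ^ 2)) * (Real.exp (-(n * (β / 2 * x ^ 2))) *
          ∑ σ ∈ A, fieldWeight (fun i => β * (x + h i)) σ) := by
        rw [Finset.mul_sum, Finset.mul_sum]
        refine Finset.sum_congr rfl fun σ hσ => ?_
        rw [gibbsWeight_eq hn x σ, hA σ hσ, mul_div_cancel_left₀ _ hn']
    _ ≤ Real.exp (n * (β / 2 * (u - x) ^ 2)) * (Real.exp (-(n * (β / 2 * x ^ 2))) *
          ∑ σ, fieldWeight (fun i => β * (x + h i)) σ) := by
        gcongr
        · exact fun σ _ _ => (fieldWeight_pos _ σ).le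
        · exact A.subset_univ
    _ = Real.exp (n * (β / 2 * (u - x) ^ 2) - empiricalG β h n x) := by
        rw [exp_mul_sum_fieldWeight, ← Real.exp_add, ← sub_eq_add_neg]

lemma sum_gibbsWeight_le (hn : n ≠ 0) (A : Finset (Fin n → ℤˣ)) {M : ℝ}
    (hM : ∀ σ ∈ A, ∃ x : ℝ,
      n * (β / 2 * (magnetization σ / n - x) ^ 2) - empiricalG β h n x ≤ M) :
    ∑ σ ∈ A, gibbsWeight β h σ ≤ (2 * n + 1) * Real.exp M := by
  have hn' : (n : ℝ) ≠ 0 := Nat.cast_ne_zero.2 hn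
  calc ∑ σ ∈ A, gibbsWeight β h σ
      = ∑ s ∈ A.image magnetization, ∑ σ ∈ A with magnetization σ = s, gibbsWeight β h σ :=
        (Finset.sum_fiberwise_of_maps_to (fun _ => Finset.mem_image_of_mem _) _).symm
    _ ≤ (A.image magnetization).card • Real.exp M := by
        refine Finset.sum_le_card_nsmul _ _ _ fun s hs => ?_
        obtain ⟨τ, hτ, rfl⟩ := Finset.mem_image.1 hs
        obtain ⟨x, hx⟩ := hM τ hτ
        refine (sum_gibbsWeight_le_of_magnetization_eq hn _ (fun σ hσ => ?_) x).trans
          (Real.exp_le_exp.2 hx)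
        rw [(Finset.mem_filter.1 hσ).2, mul_div_cancel₀ _ hn']
    _ ≤ (2 * n + 1) * Real.exp M := by
        rw [nsmul_eq_mul]
        gcongr
        exact_mod_cast card_image_magnetization_le A

lemma le_sum_gibbsWeight (hn : n ≠ 0) (x K : ℝ) {r : ℝ} (hr : 0 ≤ r) (A : Finset (Fin n → ℤˣ))
    (hA : ∀ σ, |magnetization σ - ∑ i ∈ Finset.range n, Real.tanh (β * (x + h i))| < n * r →
      σ ∈ A ∧ K ≤ n * (β / 2 * (magnetization σ / n - x) ^ 2)) :
    Real.exp (K - empiricalG β h n x) * (1 - 2 * Real.exp (-(n * r ^ 2 / 2))) ≤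
      ∑ σ ∈ A, gibbsWeight β h σ := by
  have hconc := le_sum_fieldWeight_of_concentration (fun i : Fin n => β * (x + h i)) hr
  rw [Fin.sum_univ_eq_sum_range fun i => Real.tanh (β * (x + h i))] at hconc
  set T : Finset (Fin n → ℤˣ) :=
    {σ | |magnetization σ - ∑ i ∈ Finset.range n, Real.tanh (β * (x + h i))| < n * r}
  have hmem {σ} (hσ : σ ∈ T) := hA σ (Finset.mem_filter.1 hσ).2
  calc _ = Real.exp K * (Real.exp (-(n * (β / 2 * x ^ 2))) *
        (Real.exp (∑ i : Fin n, Real.log (2 * Real.cosh (β * (x + h i))))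
          * (1 - 2 * Real.exp (-(n * r ^ 2 / 2))))) := by
        rw [sub_eq_add_neg, Real.exp_add, ← exp_mul_exp_sum_log_eq_exp_neg_empiricalG]
        ring
    _ ≤ Real.exp K * (Real.exp (-(n * (β / 2 * x ^ 2))) *
        ∑ σ ∈ T, fieldWeight (fun i : Fin n => β * (x + h i)) σ) := by gcongr
    _ ≤ ∑ σ ∈ T, gibbsWeight β h σ := by
        rw [Finset.mul_sum, Finset.mul_sum]
        refine Finset.sum_le_sum fun σ hσ => ?_
        rw [gibbsWeight_eq hn x σ]
        exact mul_le_mul_of_nonneg_right (Real.exp_le_exp.2 (hmem hσ).2)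
          (mul_nonneg (Real.exp_pos _).le (fieldWeight_pos _ σ).le)
    _ ≤ ∑ σ ∈ A, gibbsWeight β h σ :=
        Finset.sum_le_sum_of_subset_of_nonneg (fun σ hσ => (hmem hσ).1)
          fun σ _ _ => (gibbsWeight_pos β h σ).le

lemma measurable_magnetization (n : ℕ) : Measurable (magnetization (n := n)) :=
  Finset.measurable_sum _ fun i _ =>
    measurable_from_top.comp ((comap_measurable Units.val).comp (measurable_pi_apply i))

open Classical in
lemma scaledMagnetizationLaw_apply (β : ℝ) (h : ℕ → ℝ) (m α : ℝ) (n : ℕ) {C : Set ℝ}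
    (hC : MeasurableSet C) :
    scaledMagnetizationLaw β h m α n C = ENNReal.ofReal
      ((∑ σ : Fin n → ℤˣ with (magnetization σ - n * m) / (n : ℝ) ^ α ∈ C, gibbsWeight β h σ)
        / partitionFunction β h n) := by
  have hmeas : Measurable fun σ : Fin n → ℤˣ => (magnetization σ - n * m) / (n : ℝ) ^ α :=
    ((measurable_magnetization n).sub_const _).div_const _
  rw [scaledMagnetizationLaw, Measure.map_apply hmeas hC, gibbsMeasure, Measure.finsetSum_apply,
    Finset.sum_div, ENNReal.ofReal_sum_of_nonneg
      (fun σ _ => div_nonneg (gibbsWeight_pos β h σ).le (partitionFunction_pos β h n).le),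
    Finset.sum_filter]
  refine Finset.sum_congr rfl fun σ _ => ?_
  rw [Measure.smul_apply, Measure.dirac_apply' _ (hmeas hC), Set.indicator_apply]
  simp only [Set.mem_preimage, Pi.one_apply, smul_eq_mul, mul_ite, mul_one, mul_zero, gibbsWeight]

end GibbsWeights

section Expansion

variable {β : ℝ} {ν : Measure ℝ} {m : ℝ} {k : ℕ} {lam : ℝ}

lemma hasDerivAt_integral_comp_mul_add [IsFiniteMeasure ν] {f f' : ℝ → ℝ} {C : ℝ}
    (hderiv : ∀ y, HasDerivAt f (f' y) y) (hf' : Continuous f') (hC : ∀ y, |f' y| ≤ C) {x : ℝ}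
    (hint : Integrable (fun h => f (β * (x + h))) ν) :
    HasDerivAt (fun y => ∫ h, f (β * (y + h)) ∂ν) (β * ∫ h, f' (β * (x + h)) ∂ν) x := by
  have hinner (h y : ℝ) : HasDerivAt (fun y => f (β * (y + h))) (β * f' (β * (y + h))) y := by
    have haff : HasDerivAt (fun y => β * (y + h)) β y := by
      simpa using ((hasDerivAt_id y).add_const h).const_mul β
    exact ((hderiv _).comp y haff).congr_deriv (mul_comm _ _)
  have hf : Continuous f := continuous_iff_continuousAt.2 fun y => (hderiv y).continuousAt
  rw [← integral_const_mul]
  refine (hasDerivAt_integral_of_dominated_loc_of_deriv_le (bound := fun _ => |β| * C) univ_mem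
    (.of_forall fun y => (by fun_prop : Continuous _).aestronglyMeasurable) hint
    (by fun_prop : Continuous _).aestronglyMeasurable
    (ae_of_all _ fun h y _ => ?_) (integrable_const _)
    (ae_of_all _ fun h y _ => hinner h y)).2
  rw [norm_mul]
  exact mul_le_mul_of_nonneg_left (hC _) (abs_nonneg β)

/-- The mean magnetization per site of independent spins in the fields `β (x + h)`, averaged over
`h`; the critical points of `G` are its fixed points. -/
noncomputable def meanMagnetization (β : ℝ) (ν : Measure ℝ) (x : ℝ) : ℝ :=
  ∫ h, Real.tanh (β * (x + h)) ∂ν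

/-- The response of the mean magnetization to the external field `x`. -/
noncomputable def susceptibility (β : ℝ) (ν : Measure ℝ) (x : ℝ) : ℝ :=
  β * ∫ h, 1 / Real.cosh (β * (x + h)) ^ 2 ∂ν

lemma integrable_tanh_mul_add [IsFiniteMeasure ν] (β x : ℝ) :
    Integrable (fun h => Real.tanh (β * (x + h))) ν :=
  .of_bound (continuous_tanh.comp (by fun_prop)).aestronglyMeasurable 1
    (ae_of_all _ fun _ => (Real.abs_tanh_lt_one _).le)

lemma integrable_one_div_cosh_sq_mul_add [IsFiniteMeasure ν] (β x : ℝ) :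
    Integrable (fun h => 1 / Real.cosh (β * (x + h)) ^ 2) ν :=
  .of_bound (continuous_one_div_cosh_sq.comp (by fun_prop)).aestronglyMeasurable 1
    (ae_of_all _ fun _ => abs_one_div_cosh_sq_le_one _)

lemma integrable_log_cosh_mul_add [IsFiniteMeasure ν] (hν : Integrable (fun x : ℝ => x) ν)
    (β x : ℝ) : Integrable (fun h => Real.log (Real.cosh (β * (x + h)))) ν := by
  have hlin : Integrable (fun h => β * (x + h)) ν := ((integrable_const x).add hν).const_mul β
  have hcont : Continuous fun h => Real.log (Real.cosh (β * (x + h))) :=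
    Continuous.log (by fun_prop) fun h => (Real.cosh_pos _).ne'
  exact hlin.mono hcont.aestronglyMeasurable (ae_of_all _ fun h => abs_log_cosh_le_abs _)

lemma hasDerivAt_meanMagnetization [IsFiniteMeasure ν] (x : ℝ) :
    HasDerivAt (meanMagnetization β ν) (susceptibility β ν x) x :=
  hasDerivAt_integral_comp_mul_add hasDerivAt_tanh continuous_one_div_cosh_sq
    abs_one_div_cosh_sq_le_one (integrable_tanh_mul_add β x)

lemma hasDerivAt_G [IsFiniteMeasure ν] (hν : Integrable (fun x : ℝ => x) ν) (x : ℝ) :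
    HasDerivAt (G β ν) (β * (x - meanMagnetization β ν x)) x := by
  have hquad : HasDerivAt (fun y : ℝ => β / 2 * y ^ 2) (β * x) x :=
    ((hasDerivAt_pow 2 x).const_mul (β / 2)).congr_deriv (by norm_num; ring)
  rw [mul_sub]
  exact hquad.sub (hasDerivAt_integral_comp_mul_add hasDerivAt_log_cosh continuous_tanh
    (fun y => (Real.abs_tanh_lt_one y).le) (integrable_log_cosh_mul_add hν β x))

lemma susceptibility_pos [IsFiniteMeasure ν] [NeZero ν] (hβ : 0 < β) (x : ℝ) :
    0 < susceptibility β ν x := by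
  refine mul_pos hβ ((integral_pos_iff_support_of_nonneg (fun h => (one_div_cosh_sq_pos _).le)
    (integrable_one_div_cosh_sq_mul_add β x)).2 ?_)
  rw [Function.support_eq_univ fun h => (one_div_cosh_sq_pos _).ne']
  exact Measure.measure_univ_pos.2 (NeZero.ne ν)

lemma IsPureCenteredAt.G_le (hm : IsPureCenteredAt β ν m) (x : ℝ) : G β ν m ≤ G β ν x :=
  (hm.ge rfl : IsMinOn (G β ν) Set.univ m) (Set.mem_univ x)

lemma IsPureCenteredAt.G_lt (hm : IsPureCenteredAt β ν m) {x : ℝ} (hx : x ≠ m) :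
    G β ν m < G β ν x :=
  (hm.G_le x).lt_of_ne fun he => hx <| hm.le fun y _ => he.ge.trans (hm.G_le y)

lemma IsPureCenteredAt.meanMagnetization_eq [IsFiniteMeasure ν] (hm : IsPureCenteredAt β ν m)
    (hβ : β ≠ 0) (hν : Integrable (fun x : ℝ => x) ν) : meanMagnetization β ν m = m := by
  have hcrit := IsLocalMin.hasDerivAt_eq_zero (.of_forall hm.G_le) (hasDerivAt_G hν m)
  exact (sub_eq_zero.1 ((mul_eq_zero.1 hcrit).resolve_left hβ)).symm

lemma IsPureCenteredAt.meanMagnetization_isLittleO [IsFiniteMeasure ν]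
    (hm : IsPureCenteredAt β ν m) (hβ : β ≠ 0) (hν : Integrable (fun x : ℝ => x) ν) :
    (fun x => meanMagnetization β ν x - m - susceptibility β ν m * (x - m)) =o[𝓝 m]
      fun x => x - m := by
  have hderiv := (hasDerivAt_meanMagnetization (β := β) (ν := ν) m).isLittleO
  simpa only [hm.meanMagnetization_eq hβ hν, smul_eq_mul, mul_comm] using hderiv

lemma IsPureCenteredAt.G_isLittleO [IsFiniteMeasure ν] (hm : IsPureCenteredAt β ν m)
    (hβ : β ≠ 0) (hν : Integrable (fun x : ℝ => x) ν) :
    (fun x => G β ν x - G β ν m - β * (1 - susceptibility β ν m) / 2 * (x - m) ^ 2) =o[𝓝 m]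
      fun x => (x - m) ^ 2 := by
  set χ := susceptibility β ν m
  have hderiv (x : ℝ) : HasDerivAt (fun x => G β ν x - β * (1 - χ) / 2 * (x - m) ^ 2)
      (-β * (meanMagnetization β ν x - m - χ * (x - m))) x := by
    have hquad := (((hasDerivAt_id x).sub_const m).pow 2).const_mul (β * (1 - χ) / 2)
    refine ((hasDerivAt_G hν x).sub hquad).congr_deriv ?_
    simp only [id, Nat.cast_ofNat, Nat.add_one_sub_one, pow_one, mul_one]
    ring
  have hsmall : (fun x => -β * (meanMagnetization β ν x - m - χ * (x - m))) =o[𝓝[Set.univ] m]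
      fun x => (x - m) ^ 1 := by
    simpa only [nhdsWithin_univ, pow_one] using
      (hm.meanMagnetization_isLittleO hβ hν).const_mul_left (-β)
  have hint := convex_univ.isLittleO_pow_succ_real (Set.mem_univ m)
    (fun x _ => (hderiv x).hasDerivWithinAt) hsmall
  rw [nhdsWithin_univ] at hint
  exact hint.congr_left fun x => by ring

lemma isLittleO_sub_pow_sub_pow (m : ℝ) {p q : ℕ} (hpq : p < q) :
    (fun x : ℝ => (x - m) ^ q) =o[𝓝 m] fun x => (x - m) ^ p :=
  (isLittleO_pow_pow hpq).comp_tendsto (tendsto_sub_nhds_zero_iff.2 tendsto_id)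

lemma eq_zero_of_const_mul_sub_pow_isLittleO {a m : ℝ} {p : ℕ}
    (h : (fun x : ℝ => a * (x - m) ^ p) =o[𝓝 m] fun x => (x - m) ^ p) : a = 0 := by
  by_contra ha
  have hself := (isLittleO_const_mul_left_iff ha).1 h
  refine isLittleO_irrefl ?_ (hself.mono nhdsWithin_le_nhds : _ =o[𝓝[≠] m] _)
  refine Eventually.frequently ?_
  filter_upwards [self_mem_nhdsWithin] with x hx
  exact pow_ne_zero p (sub_ne_zero.2 hx)

lemma HasTypeStrength.G_isLittleO (hk : HasTypeStrength β ν m k lam) {p : ℕ} (hp : p ≤ 2 * k) :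
    (fun x => G β ν x - G β ν m - lam / ((2 * k).factorial : ℝ) * (x - m) ^ (2 * k)) =o[𝓝 m]
      fun x => (x - m) ^ p :=
  (hk.expansion.trans_isLittleO (isLittleO_sub_pow_sub_pow m (by omega))).congr_left
    fun x => by ring

/-- `β (1 - χ)` is the second derivative of `G` at `m`. -/
lemma HasTypeStrength.mul_one_sub_susceptibility [IsFiniteMeasure ν]
    (hk : HasTypeStrength β ν m k lam) (hm : IsPureCenteredAt β ν m) (hβ : β ≠ 0)
    (hν : Integrable (fun x : ℝ => x) ν) :
    β * (1 - susceptibility β ν m) = if k = 1 then lam else 0 := by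
  have hone := hk.one_le_type
  have hdiff := (hk.G_isLittleO (show 2 ≤ 2 * k by omega)).sub (hm.G_isLittleO hβ hν)
  split_ifs with hk1
  · subst hk1
    have hzero : β * (1 - susceptibility β ν m) / 2 - lam / 2 = 0 :=
      eq_zero_of_const_mul_sub_pow_isLittleO <| hdiff.congr_left fun x => by
        norm_num [Nat.factorial]
        ring
    linarith
  · have hhigh : (fun x => lam / ((2 * k).factorial : ℝ) * (x - m) ^ (2 * k)) =o[𝓝 m]
        fun x => (x - m) ^ 2 := (isLittleO_sub_pow_sub_pow m (by omega)).const_mul_left _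
    have hzero : β * (1 - susceptibility β ν m) / 2 = 0 :=
      eq_zero_of_const_mul_sub_pow_isLittleO <| (hdiff.add hhigh).congr_left fun x => by ring
    linarith

lemma rateFunction_eq_mul_pow (β : ℝ) (k : ℕ) (lam x : ℝ) :
    rateFunction β k lam x = rateFunction β k lam 1 * x ^ (2 * k) := by
  unfold rateFunction
  split_ifs with hk1
  · rw [hk1]
    ring
  · ring

lemma continuous_rateFunction (β : ℝ) (k : ℕ) (lam : ℝ) : Continuous (rateFunction β k lam) := by
  rw [funext (rateFunction_eq_mul_pow β k lam)]
  fun_prop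

lemma HasTypeStrength.rateFunction_one_pos [IsFiniteMeasure ν] [NeZero ν]
    (hk : HasTypeStrength β ν m k lam) (hm : IsPureCenteredAt β ν m) (hβ : 0 < β)
    (hν : Integrable (fun x : ℝ => x) ν) : 0 < rateFunction β k lam 1 := by
  have hlam := hk.strength_pos
  have hcurv := hk.mul_one_sub_susceptibility hm hβ.ne' hν
  unfold rateFunction
  split_ifs at hcurv ⊢ with hk1
  · have hlt : lam < β := by linarith [mul_pos hβ (susceptibility_pos (ν := ν) hβ m)]
    have := sub_pos.2 (inv_strictAnti₀ hlam hlt)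
    positivity
  · positivity

/-- The quadratic term `β ((1 - c) w)² / 2`, the price of evaluating at `m + c w` instead of
`m + w`, turns the leading term of `G` into the rate function. -/
lemma HasTypeStrength.rateFunction_eq_sub [IsFiniteMeasure ν] [NeZero ν]
    (hk : HasTypeStrength β ν m k lam) (hm : IsPureCenteredAt β ν m) (hβ : 0 < β)
    (hν : Integrable (fun x : ℝ => x) ν) (w : ℝ) :
    rateFunction β k lam w = lam / ((2 * k).factorial : ℝ) *
        ((susceptibility β ν m)⁻¹ * w) ^ (2 * k) -
      β / 2 * ((1 - (susceptibility β ν m)⁻¹) * w) ^ 2 := by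
  have hlam := hk.strength_pos
  have hχ := susceptibility_pos (ν := ν) hβ m
  have hcurv := hk.mul_one_sub_susceptibility hm hβ.ne' hν
  set χ := susceptibility β ν m
  unfold rateFunction
  split_ifs at hcurv ⊢ with hk1
  · subst hk1
    have hgap : β - lam = β * χ := by linarith
    rw [inv_sub_inv hlam.ne' hβ.ne', hgap, ← hcurv]
    norm_num [Nat.factorial]
    field_simp
    ring
  · have hχ1 : χ = 1 := by
      linarith [(mul_eq_zero.1 hcurv).resolve_left hβ.ne']
    rw [hχ1]
    ring

lemma HasTypeStrength.sub_le_quadratic [IsFiniteMeasure ν]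
    (hk : HasTypeStrength β ν m k lam) (hm : IsPureCenteredAt β ν m) (hβ : 0 < β)
    (hν : Integrable (fun x : ℝ => x) ν) {s u y δ : ℝ} (hs : 0 ≤ s)
    (hu : |u - (m + s * y)| ≤ s * δ) :
    β / 2 * ((1 - (susceptibility β ν m)⁻¹) * (s * y)) ^ 2 -
        s ^ (2 * k) * (β * |1 - (susceptibility β ν m)⁻¹| * |y| * δ) ≤
      β / 2 * (u - (m + (susceptibility β ν m)⁻¹ * y * s)) ^ 2 := by
  have hcurv := hk.mul_one_sub_susceptibility hm hβ.ne' hν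
  set c := (susceptibility β ν m)⁻¹ with hc
  have hscale : |1 - c| * s ^ (2 * k) = |1 - c| * s ^ 2 := by
    split_ifs at hcurv with hk1
    · rw [hk1]
    · have hχ : susceptibility β ν m = 1 := by
        linarith [(mul_eq_zero.1 hcurv).resolve_left hβ.ne']
      simp only [hc, hχ, inv_one, sub_self, abs_zero, zero_mul]
  set b := (1 - c) * (s * y) with hb
  have hcross : |b * (u - (m + s * y))| ≤ |1 - c| * s ^ (2 * k) * (|y| * δ) := by
    calc |b * (u - (m + s * y))| ≤ |1 - c| * (s * |y|) * (s * δ) := by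
          rw [abs_mul, hb, abs_mul, abs_mul s, abs_of_nonneg hs]
          gcongr
      _ = |1 - c| * s ^ (2 * k) * (|y| * δ) := by
          rw [hscale]
          ring
  have hexpand : (u - (m + c * y * s)) ^ 2 =
      b ^ 2 + 2 * (b * (u - (m + s * y))) + (u - (m + s * y)) ^ 2 := by
    rw [hb]
    ring
  rw [hexpand]
  nlinarith [mul_le_mul_of_nonneg_left (neg_le_of_abs_le hcross) hβ.le,
    mul_nonneg hβ.le (sq_nonneg (u - (m + s * y)))]

end Expansion

section TiltedField

variable {β : ℝ} {ν : Measure ℝ} {m : ℝ} {k : ℕ} {lam : ℝ} [IsFiniteMeasure ν]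

lemma IsPureCenteredAt.exists_gap (hm : IsPureCenteredAt β ν m)
    (hν : Integrable (fun x : ℝ => x) ν) {δ : ℝ} (hδ : 0 < δ) (R : ℝ) :
    ∃ κ > 0, ∀ w : ℝ, δ ≤ |w| → |w| ≤ R → κ ≤ G β ν (m + w) - G β ν m := by
  have hcont : Continuous (G β ν) :=
    continuous_iff_continuousAt.2 fun x => (hasDerivAt_G hν x).continuousAt
  have hcompact : IsCompact {w : ℝ | δ ≤ |w| ∧ |w| ≤ R} := by
    refine (isCompact_closedBall (0 : ℝ) R).of_isClosed_subset ?_ fun w hw => ?_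
    · exact (isClosed_le continuous_const continuous_abs).inter
        (isClosed_le continuous_abs continuous_const)
    · simpa using hw.2
  obtain ⟨κ, hκ, hle⟩ := hcompact.exists_forall_le' (f := fun w => G β ν (m + w) - G β ν m)
    (a := 0) (by fun_prop) fun w hw => sub_pos.2 <| hm.G_lt fun hw0 => by
      have : w = 0 := by linarith
      simp only [this, abs_zero, Set.mem_ofPred_eq] at hw
      linarith
  exact ⟨κ, hκ, fun w hδw hwR => hle w ⟨hδw, hwR⟩⟩

variable [NeZero ν]

lemma HasTypeStrength.tiltedG_isLittleO (hk : HasTypeStrength β ν m k lam)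
    (hm : IsPureCenteredAt β ν m) (hβ : 0 < β) (hν : Integrable (fun x : ℝ => x) ν) :
    (fun w => β / 2 * ((1 - (susceptibility β ν m)⁻¹) * w) ^ 2 -
        (G β ν (m + (susceptibility β ν m)⁻¹ * w) - G β ν m) + rateFunction β k lam w)
      =o[𝓝 0] fun w => w ^ (2 * k) := by
  set c := (susceptibility β ν m)⁻¹ with hc
  have hfield : Tendsto (fun w => m + c * w) (𝓝 0) (𝓝 m) :=
    (by fun_prop : Continuous fun w => m + c * w).tendsto' _ _ (by ring)
  have hG := (hk.G_isLittleO le_rfl).comp_tendsto hfield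
  have hpow : (fun w => (m + c * w - m) ^ (2 * k)) =O[𝓝 0] fun w : ℝ => w ^ (2 * k) :=
    (isBigO_const_mul_self (c ^ (2 * k)) _ _).congr_left fun w => by ring
  refine (hG.trans_isBigO hpow).neg_left.congr_left fun w => ?_
  rw [hk.rateFunction_eq_sub hm hβ hν w, ← hc, Function.comp_apply]
  ring

lemma HasTypeStrength.exists_pos_eventually_tiltedG_le (hk : HasTypeStrength β ν m k lam)
    (hm : IsPureCenteredAt β ν m) (hβ : 0 < β) (hν : Integrable (fun x : ℝ => x) ν)
    {ε : ℝ} (hε : 0 < ε) :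
    ∃ ε' > 0, ∀ᶠ w in 𝓝 0, |(susceptibility β ν m)⁻¹ * w| ≤ 1 ∧
      β / 2 * ((1 - (susceptibility β ν m)⁻¹) * w) ^ 2 -
          (G β ν (m + (susceptibility β ν m)⁻¹ * w) - G β ν m) +
          ε' * ((susceptibility β ν m)⁻¹ * w) ^ (2 * k) ≤
        -((1 - ε) * rateFunction β k lam w) := by
  have hc0 : 0 < (susceptibility β ν m)⁻¹ := inv_pos.2 (susceptibility_pos hβ m)
  have hexp := hk.tiltedG_isLittleO hm hβ hν
  set c := (susceptibility β ν m)⁻¹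
  set A := rateFunction β k lam 1
  have hA : 0 < A := hk.rateFunction_one_pos hm hβ hν
  have hsmall : ∀ᶠ w in 𝓝 (0 : ℝ), |c * w| < 1 :=
    (by fun_prop : Continuous fun w => |c * w|).continuousAt.eventually_lt
      continuousAt_const (by simp)
  refine ⟨ε / 2 * A / c ^ (2 * k), by positivity, ?_⟩
  filter_upwards [hsmall, hexp.def (by positivity : 0 < ε / 2 * A)] with w hw hle
  refine ⟨hw.le, ?_⟩
  rw [Real.norm_eq_abs, Real.norm_eq_abs, abs_pow, (even_two_mul k).pow_abs] at hle
  have hcancel : ε / 2 * A / c ^ (2 * k) * (c * w) ^ (2 * k) = ε / 2 * A * w ^ (2 * k) := by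
    rw [mul_pow]
    field_simp
  rw [hcancel, rateFunction_eq_mul_pow]
  rw [rateFunction_eq_mul_pow] at hle
  linarith [(abs_le.1 hle).2]

/-- The term `ε' (x - m) ^ (2k)` absorbs the random fluctuations of `empiricalG`. -/
lemma HasTypeStrength.exists_field (hk : HasTypeStrength β ν m k lam)
    (hm : IsPureCenteredAt β ν m) (hβ : 0 < β) (hν : Integrable (fun x : ℝ => x) ν)
    {ε : ℝ} (hε : 0 < ε) :
    ∃ ε' > 0, ∃ κ > 0, ∀ u : ℝ, |u| ≤ 1 → ∃ x : ℝ, |x| ≤ |m| + 1 ∧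
      β / 2 * (u - x) ^ 2 - (G β ν x - G β ν m) + ε' * (x - m) ^ (2 * k) ≤
        -min ((1 - ε) * rateFunction β k lam (u - m)) κ := by
  obtain ⟨ε₁, hε₁, hev⟩ := hk.exists_pos_eventually_tiltedG_le hm hβ hν hε
  obtain ⟨δ, hδ, hnear⟩ := Metric.eventually_nhds_iff.1 hev
  obtain ⟨κ, hκ, hgap⟩ := hm.exists_gap hν hδ (1 + |m|)
  set c := (susceptibility β ν m)⁻¹
  set B := (1 + |m|) ^ (2 * k)
  have hB : 0 < B := by positivity
  refine ⟨min ε₁ (κ / 2 / B), by positivity, κ / 2, half_pos hκ, fun u hu => ?_⟩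
  have hdist : |u - m| ≤ 1 + |m| := (abs_sub u m).trans (add_le_add_left hu _)
  rcases lt_or_ge |u - m| δ with hclose | hfar
  · obtain ⟨hfield, hle⟩ := hnear (y := u - m) (by rwa [Real.dist_0_eq_abs])
    refine ⟨m + c * (u - m), (abs_add_le _ _).trans (add_le_add_right hfield _), ?_⟩
    calc _ ≤ β / 2 * ((1 - c) * (u - m)) ^ 2 - (G β ν (m + c * (u - m)) - G β ν m) +
          ε₁ * (c * (u - m)) ^ (2 * k) := by
          rw [add_sub_cancel_left, show u - (m + c * (u - m)) = (1 - c) * (u - m) by ring]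
          gcongr
          · exact (even_two_mul k).pow_nonneg _
          · exact min_le_left _ _
      _ ≤ _ := hle.trans (neg_le_neg (min_le_left _ _))
  · refine ⟨u, by linarith [abs_nonneg m], ?_⟩
    have hG := hgap (u - m) hfar hdist
    have hpow : min ε₁ (κ / 2 / B) * (u - m) ^ (2 * k) ≤ κ / 2 / B * B := by
      rw [← (even_two_mul k).pow_abs]
      gcongr
      · exact min_le_right _ _
      · exact pow_le_pow_left₀ (abs_nonneg _) hdist _
    rw [add_sub_cancel] at hG
    rw [div_mul_cancel₀ _ hB.ne'] at hpow
    calc _ ≤ -(κ / 2) := by rw [sub_self]; linarith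
      _ ≤ _ := neg_le_neg (min_le_right _ _)

end TiltedField

section Fluctuations

variable {Ω : Type*} [MeasurableSpace Ω] {ν : Measure Ω}

/-- The fluctuation of the empirical sum `∑ i < n, g (ω i)` around its mean `n ∫ g dν`. -/
noncomputable def centeredSum (ν : Measure Ω) (g : Ω → ℝ) (ω : ℕ → Ω) (n : ℕ) : ℝ :=
  ∑ i ∈ Finset.range n, (g (ω i) - ∫ z, g z ∂ν)

lemma centeredSum_eq (g : Ω → ℝ) (ω : ℕ → Ω) (n : ℕ) :
    centeredSum ν g ω n = ∑ i ∈ Finset.range n, g (ω i) - n * ∫ z, g z ∂ν := by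
  rw [centeredSum, Finset.sum_sub_distrib, Finset.sum_const, Finset.card_range, nsmul_eq_mul]

variable [IsProbabilityMeasure ν]

lemma iIndepFun_sub_integral {g : Ω → ℝ} (hg : Measurable g) : ProbabilityTheory.iIndepFun
    (fun (i : ℕ) (ω : ℕ → Ω) => g (ω i) - ∫ z, g z ∂ν) (Measure.infinitePi fun _ : ℕ => ν) :=
  ProbabilityTheory.iIndepFun_infinitePi (X := fun _ z => g z - ∫ z, g z ∂ν)
    fun _ => hg.sub_const _

lemma hasSubgaussianMGF_sub_integral {g : Ω → ℝ} (hg : Measurable g) (hb : ∀ z, |g z| ≤ 1)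
    (i : ℕ) : ProbabilityTheory.HasSubgaussianMGF
      (fun ω : ℕ → Ω => g (ω i) - ∫ z, g z ∂ν) 1 (Measure.infinitePi fun _ : ℕ => ν) := by
  have hmp := measurePreserving_eval_infinitePi (fun _ : ℕ => ν) i
  have hsub := ProbabilityTheory.hasSubgaussianMGF_of_mem_Icc (μ := ν) hg.aemeasurable
    (ae_of_all _ fun z => abs_le.1 (hb z))
  have hconst : (‖(1 : ℝ) - -1‖₊ / 2) ^ 2 = 1 := by
    rw [sub_neg_eq_add, one_add_one_eq_two, Real.nnnorm_two, div_self two_ne_zero, one_pow]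
  rw [hconst, ← hmp.map_eq] at hsub
  have hcomp := hsub.of_map hmp.measurable.aemeasurable
  rwa [hmp.map_eq] at hcomp

lemma measure_abs_centeredSum_ge_le {g : Ω → ℝ} (hg : Measurable g) (hb : ∀ z, |g z| ≤ 1)
    (n : ℕ) {s : ℝ} (hs : 0 ≤ s) :
    Measure.infinitePi (fun _ : ℕ => ν) {ω | s ≤ |centeredSum ν g ω n|}
      ≤ ENNReal.ofReal (2 * Real.exp (-s ^ 2 / (2 * n))) := by
  have hupper := ProbabilityTheory.HasSubgaussianMGF.measure_sum_range_ge_le_of_iIndepFun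
    (iIndepFun_sub_integral (ν := ν) hg) (n := n)
    (fun i _ => hasSubgaussianMGF_sub_integral hg hb i) hs
  have hlower := ProbabilityTheory.HasSubgaussianMGF.measure_sum_range_ge_le_of_iIndepFun
    ((iIndepFun_sub_integral (ν := ν) hg).comp (fun _ y => -y) fun _ => measurable_neg) (n := n)
    (fun i _ => (hasSubgaussianMGF_sub_integral hg hb i).neg) hs
  simp only [NNReal.coe_one, mul_one, Function.comp_apply, Finset.sum_neg_distrib]
    at hupper hlower
  rw [← ofReal_measureReal]
  refine ENNReal.ofReal_le_ofReal ?_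
  simp only [le_abs, Set.ofPred_or]
  exact (measureReal_union_le _ _).trans ((add_le_add hupper hlower).trans_eq (two_mul _).symm)

lemma abs_centeredSum_le_add {f g : Ω → ℝ} (hf : Integrable f ν) (hg : Integrable g ν) {δ : ℝ}
    (hfg : ∀ z, |f z - g z| ≤ δ) (ω : ℕ → Ω) (n : ℕ) :
    |centeredSum ν f ω n| ≤ |centeredSum ν g ω n| + n * (2 * δ) := by
  have hint : |∫ z, f z ∂ν - ∫ z, g z ∂ν| ≤ δ := by
    rw [← integral_sub hf hg]
    simpa using norm_integral_le_of_norm_le_const (μ := ν) (f := fun z => f z - g z)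
      (ae_of_all _ hfg)
  have hterm : ∀ i ∈ Finset.range n,
      |(f (ω i) - ∫ z, f z ∂ν) - (g (ω i) - ∫ z, g z ∂ν)| ≤ 2 * δ := fun i _ => by
    rw [sub_sub_sub_comm]
    linarith [abs_sub (f (ω i) - g (ω i)) (∫ z, f z ∂ν - ∫ z, g z ∂ν), hfg (ω i)]
  have hsum := (Finset.abs_sum_le_sum_abs _ _).trans (Finset.sum_le_card_nsmul _ _ _ hterm)
  rw [Finset.sum_sub_distrib, Finset.card_range, nsmul_eq_mul] at hsum
  have := abs_sub_abs_le_abs_sub (centeredSum ν f ω n) (centeredSum ν g ω n)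
  unfold centeredSum at *
  linarith

lemma summable_linear_mul_exp_neg_rpow (a : ℝ) {e : ℝ} (he : 0 < e) :
    Summable fun n : ℕ => (a * n + 1) * (2 * Real.exp (-(n : ℝ) ^ e / 2)) := by
  have hpow : Tendsto (fun n : ℕ => (n : ℝ) ^ e) atTop atTop :=
    (tendsto_rpow_atTop he).comp tendsto_natCast_atTop_atTop
  have hexp := ((isLittleO_exp_neg_mul_rpow_atTop (a := 1 / 2) (by norm_num)
    (-3 / e)).comp_tendsto hpow).isBigO
  have hlin : (fun n : ℕ => a * n + 1) =O[atTop] fun n : ℕ => (n : ℝ) := by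
    refine (isBigO_const_mul_self a (fun n : ℕ => (n : ℝ)) atTop).add (IsBigO.of_bound 1 ?_)
    filter_upwards [eventually_ge_atTop 1] with n hn
    simpa using hn
  refine summable_of_isBigO_nat (g := fun n : ℕ => (n : ℝ) ^ (-2 : ℝ))
    (Real.summable_nat_rpow.2 (by norm_num)) ?_
  refine ((hlin.mul (hexp.const_mul_left 2)).congr_left fun n => ?_).trans
    (EventuallyEq.isBigO ?_)
  · simp only [Function.comp_apply]
    congr 3
    ring
  · filter_upwards [eventually_gt_atTop 0] with n hn
    have hn' : (0 : ℝ) < n := by exact_mod_cast hn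
    rw [Function.comp_apply, ← Real.rpow_mul hn'.le, mul_div_cancel₀ _ he.ne',
      ← Real.rpow_one_add' hn'.le (by norm_num)]
    norm_num

lemma eventually_rpow_add_le (C : ℝ) {a b : ℝ} (ha : 0 < a) (hab : a < b) :
    ∀ᶠ n : ℕ in atTop, (n : ℝ) ^ a + C ≤ (n : ℝ) ^ b := by
  have hge (p : ℝ) (hp : 0 < p) (D : ℝ) : ∀ᶠ n : ℕ in atTop, D ≤ (n : ℝ) ^ p :=
    ((tendsto_rpow_atTop hp).comp tendsto_natCast_atTop_atTop).eventually_ge_atTop D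
  filter_upwards [hge a ha C, hge (b - a) (sub_pos.2 hab) 2, eventually_gt_atTop 0]
    with n hC h2 hn
  have hn' : (0 : ℝ) < n := by exact_mod_cast hn
  rw [← add_sub_cancel a b, Real.rpow_add hn']
  nlinarith [Real.rpow_pos_of_pos hn' a]

lemma sq_rpow_half_add_div (n : ℕ) {e : ℝ} (he : 0 < e) :
    -((n : ℝ) ^ (1 / 2 + e)) ^ 2 / (2 * n) = -(n : ℝ) ^ (2 * e) / 2 := by
  rcases Nat.eq_zero_or_pos n with rfl | hn
  · simp [Real.zero_rpow (by positivity : 2 * e ≠ 0)]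
  · have hn' : (0 : ℝ) < n := by exact_mod_cast hn
    have hsq : ((n : ℝ) ^ (1 / 2 + e)) ^ 2 = n * (n : ℝ) ^ (2 * e) := by
      rw [← Real.rpow_natCast, ← Real.rpow_mul hn'.le, ← Real.rpow_one_add' hn'.le (by positivity)]
      congr 1
      push_cast
      ring
    rw [hsq]
    field_simp

lemma exists_grid_point {R n : ℕ} (hn : 0 < n) {x : ℝ} (hx : |x| ≤ R) :
    ∃ j ∈ Finset.range (2 * R * n + 1), |x - ((j : ℝ) / n - R)| ≤ 1 / n := by
  have hn' : (0 : ℝ) < n := by exact_mod_cast hn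
  obtain ⟨hx₁, hx₂⟩ := abs_le.1 hx
  have hle : ((⌊(x + R) * n⌋₊ : ℕ) : ℝ) ≤ (x + R) * n :=
    Nat.floor_le (mul_nonneg (by linarith) hn'.le)
  have hlt := Nat.lt_floor_add_one ((x + R) * n)
  refine ⟨⌊(x + R) * n⌋₊, ?_, ?_⟩
  · rw [Finset.mem_range, Nat.lt_succ_iff]
    refine Nat.floor_le_of_le ?_
    push_cast
    gcongr
    linarith
  · rw [show x - ((⌊(x + R) * n⌋₊ : ℝ) / n - R) = ((x + R) * n - ⌊(x + R) * n⌋₊) / n by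
      field_simp; ring, abs_div, abs_of_pos hn', abs_of_nonneg (by linarith)]
    gcongr
    linarith

variable {f : ℝ → Ω → ℝ}

lemma ae_eventually_grid_abs_centeredSum_lt (hf : ∀ x, Measurable (f x))
    (hb : ∀ x z, |f x z| ≤ 1) (R : ℕ) {e : ℝ} (he : 0 < e) :
    ∀ᵐ ω ∂Measure.infinitePi (fun _ : ℕ => ν), ∀ᶠ n : ℕ in atTop,
      ∀ j ∈ Finset.range (2 * R * n + 1),
        |centeredSum ν (f ((j : ℝ) / n - R)) ω n| < (n : ℝ) ^ (1 / 2 + e) := by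
  set bad : ℕ → Set (ℕ → Ω) := fun n => ⋃ j ∈ Finset.range (2 * R * n + 1),
    {ω | (n : ℝ) ^ (1 / 2 + e) ≤ |centeredSum ν (f ((j : ℝ) / n - R)) ω n|}
  have hbound : ∀ n, Measure.infinitePi (fun _ : ℕ => ν) (bad n) ≤
      ENNReal.ofReal (((2 * R : ℝ) * n + 1) * (2 * Real.exp (-(n : ℝ) ^ (2 * e) / 2))) := by
    intro n
    refine (measure_biUnion_finset_le _ _).trans ((Finset.sum_le_card_nsmul _ _ _ fun j _ =>
      measure_abs_centeredSum_ge_le (hf _) (hb _) n (by positivity)).trans_eq ?_)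
    rw [Finset.card_range, nsmul_eq_mul, sq_rpow_half_add_div n he,
      ENNReal.ofReal_mul (p := 2 * R * n + 1) (by positivity), ← ENNReal.ofReal_natCast]
    push_cast
    rfl
  have hfin : ∑' n, Measure.infinitePi (fun _ : ℕ => ν) (bad n) ≠ ⊤ :=
    ((ENNReal.tsum_le_tsum hbound).trans_lt
      (summable_linear_mul_exp_neg_rpow (2 * R) (by positivity)).tsum_ofReal_lt_top).ne
  filter_upwards [ae_eventually_notMem hfin] with ω hω
  filter_upwards [hω] with n hn j hj
  exact not_le.1 fun hge => hn (Set.mem_biUnion hj hge)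

lemma ae_eventually_abs_centeredSum_le_add (hf : ∀ x, Measurable (f x))
    (hb : ∀ x z, |f x z| ≤ 1) {L : ℝ} (hL : ∀ x y z, |f x z - f y z| ≤ L * |x - y|)
    (R : ℕ) {e : ℝ} (he : 0 < e) :
    ∀ᵐ ω ∂Measure.infinitePi (fun _ : ℕ => ν), ∀ᶠ n : ℕ in atTop, ∀ x : ℝ, |x| ≤ R →
      |centeredSum ν (f x) ω n| ≤ (n : ℝ) ^ (1 / 2 + e) + 2 * L := by
  have hint (x : ℝ) : Integrable (f x) ν :=
    Integrable.of_bound (hf x).aestronglyMeasurable 1 (ae_of_all _ (hb x))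
  have hL₀ : 0 ≤ L := by
    obtain ⟨z⟩ := nonempty_of_isProbabilityMeasure ν
    simpa using (abs_nonneg _).trans (hL 1 0 z)
  filter_upwards [ae_eventually_grid_abs_centeredSum_lt hf hb R he] with ω hω
  filter_upwards [hω, eventually_gt_atTop 0] with n hgrid hn x hx
  have hn' : (0 : ℝ) < n := by exact_mod_cast hn
  obtain ⟨j, hj, hdist⟩ := exists_grid_point hn hx
  refine (abs_centeredSum_le_add (hint x) (hint _) (hL x _) ω n).trans
    (add_le_add (hgrid j hj).le ?_)
  calc (n : ℝ) * (2 * (L * |x - ((j : ℝ) / n - R)|)) ≤ n * (2 * (L * (1 / n))) := by gcongr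
    _ = 2 * L := by field_simp

lemma ae_eventually_abs_centeredSum_le (hf : ∀ x, Measurable (f x)) (hb : ∀ x z, |f x z| ≤ 1)
    {L : ℝ} (hL : ∀ x y z, |f x z - f y z| ≤ L * |x - y|) (R : ℕ) :
    ∀ᵐ ω ∂Measure.infinitePi (fun _ : ℕ => ν), ∀ e : ℝ, 0 < e → ∀ᶠ n : ℕ in atTop,
      ∀ x : ℝ, |x| ≤ R → |centeredSum ν (f x) ω n| ≤ (n : ℝ) ^ (1 / 2 + e) := by
  filter_upwards [ae_all_iff.2 fun j : ℕ => ae_eventually_abs_centeredSum_le_add (ν := ν)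
    hf hb hL R (Nat.one_div_pos_of_nat (n := j) (α := ℝ))] with ω hω e he
  obtain ⟨j, hj⟩ := exists_nat_one_div_lt he
  filter_upwards [hω j, eventually_rpow_add_le (2 * L) (by positivity)
    (add_lt_add_right hj (1 / 2))] with n hle hrpow x hx
  exact (hle x hx).trans hrpow

end Fluctuations
section LargeDeviations

variable {P : ℕ → Measure ℝ} {a : ℕ → ℝ} {I : ℝ → ℝ}

lemma le_liminf_log_div_of_ball (ha : ∀ᶠ n in atTop, 0 < a n)
    (hball : ∀ y r ε : ℝ, 0 < r → 0 < ε → ∀ᶠ n in atTop,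
      ENNReal.ofReal (Real.exp (a n * (-I y - ε))) ≤ P n (Metric.ball y r)) (C : Set ℝ) :
    -(⨅ x ∈ interior C, (I x : EReal)) ≤
      liminf (fun n => ENNReal.log (P n C) / ((a n : ℝ) : EReal)) atTop := by
  rw [EReal.neg_le]
  refine le_iInf₂ fun y hy => ?_
  rw [EReal.neg_le, ← EReal.coe_neg]
  refine EReal.ge_of_forall_gt_iff_ge.1 fun z hz => ?_
  rw [EReal.coe_lt_coe_iff] at hz
  obtain ⟨r, hr, hsub⟩ := Metric.isOpen_iff.1 isOpen_interior y hy
  refine le_liminf_of_le (by isBoundedDefault) ?_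
  filter_upwards [ha, hball y r (-I y - z) hr (by linarith)] with n hn hlow
  rw [sub_sub_cancel] at hlow
  rw [EReal.le_div_iff_mul_le (by exact_mod_cast hn) (EReal.coe_ne_top _), ← EReal.coe_mul]
  have hlog := ENNReal.log_le_log (hlow.trans (measure_mono (hsub.trans interior_subset)))
  rwa [ENNReal.log_ofReal_of_pos (Real.exp_pos _), Real.log_exp, mul_comm] at hlog

lemma limsup_log_div_le_of_tail (ha : ∀ᶠ n in atTop, 0 < a n)
    (htail : ∀ y ε : ℝ, 0 < ε → ∀ᶠ n in atTop,
      P n {x | |y| ≤ |x|} ≤ ENNReal.ofReal (Real.exp (a n * (-I y + ε)))) (C : Set ℝ) :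
    limsup (fun n => ENNReal.log (P n C) / ((a n : ℝ) : EReal)) atTop ≤
      -(⨅ x ∈ closure C, (I x : EReal)) := by
  rcases C.eq_empty_or_nonempty with rfl | hne
  · have hbot : (fun n => ENNReal.log (P n ∅) / ((a n : ℝ) : EReal)) =ᶠ[atTop] fun _ => ⊥ := by
      filter_upwards [ha] with n hn
      rw [measure_empty, ENNReal.log_zero]
      exact EReal.bot_div_of_pos_ne_top (by exact_mod_cast hn) (EReal.coe_ne_top _)
    rw [limsup_congr hbot, limsup_const]
    exact bot_le
  obtain ⟨y, hy, hmin⟩ := isClosed_closure.exists_infDist_eq_dist hne.closure (0 : ℝ)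
  have hsub : C ⊆ {x | |y| ≤ |x|} := fun x hx => by
    simpa only [hmin, dist_zero_left, Real.norm_eq_abs, Set.mem_ofPred_eq] using
      Metric.infDist_le_dist_of_mem (x := (0 : ℝ)) (subset_closure hx)
  refine le_trans ?_ (EReal.neg_le_neg_iff.2 (iInf₂_le y hy))
  rw [← EReal.coe_neg]
  refine EReal.le_of_forall_lt_iff_le.1 fun z hz => ?_
  rw [EReal.coe_lt_coe_iff] at hz
  refine limsup_le_of_le (by isBoundedDefault) ?_
  filter_upwards [ha, htail y (z + I y) (by linarith)] with n hn hup
  rw [neg_add_cancel_comm_assoc] at hup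
  rw [EReal.div_le_iff_le_mul (by exact_mod_cast hn) (EReal.coe_ne_top _), ← EReal.coe_mul]
  have hlog := ENNReal.log_le_log ((measure_mono hsub).trans hup)
  rwa [ENNReal.log_ofReal_of_pos (Real.exp_pos _), Real.log_exp] at hlog

/-- In dimension one the tails `{x | |y| ≤ |x|}` suffice for the upper bound: every set lies in
the tail determined by a point of its closure nearest to the origin. -/
lemma satisfiesLDP_of_tail_of_ball (hI : Continuous I) (hcoercive : Tendsto I (cocompact ℝ) atTop)
    (ha : ∀ᶠ n in atTop, 0 < a n)
    (htail : ∀ y ε : ℝ, 0 < ε → ∀ᶠ n in atTop,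
      P n {x | |y| ≤ |x|} ≤ ENNReal.ofReal (Real.exp (a n * (-I y + ε))))
    (hball : ∀ y r ε : ℝ, 0 < r → 0 < ε → ∀ᶠ n in atTop,
      ENNReal.ofReal (Real.exp (a n * (-I y - ε))) ≤ P n (Metric.ball y r)) :
    SatisfiesLDP P a fun x => (I x : EReal) where
  lowerSemicontinuous := (continuous_coe_real_ereal.comp hI).lowerSemicontinuous
  isCompact_level c := by
    simp only [EReal.coe_le_coe_iff]
    obtain ⟨K, hK, hsub⟩ := mem_cocompact.1 (hcoercive.eventually_gt_atTop c)
    refine hK.of_isClosed_subset (isClosed_le hI continuous_const) fun x hx => ?_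
    by_contra hxK
    have hlt : c < I x := hsub hxK
    exact hlt.not_ge hx
  lower_bound C _ := le_liminf_log_div_of_ball ha hball C
  upper_bound C _ := limsup_log_div_le_of_tail ha htail C

end LargeDeviations
section ModerateScale

variable {β : ℝ} {ν : Measure ℝ} {m : ℝ} {k : ℕ} {lam : ℝ} {h : ℕ → ℝ} {t : ℕ → ℝ}

/-- The realization `h` of the field is typical at the scale `t`: near `m` the fluctuations of the
empirical mean magnetization are negligible against `t ^ (2k - 1)`, and `log n` is negligible
against the speed `n t ^ (2k)`. -/
structure HasModerateFluctuations (β : ℝ) (ν : Measure ℝ) (m : ℝ) (k : ℕ) (h t : ℕ → ℝ) :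
    Prop where
  eventually_pos : ∀ᶠ n in atTop, 0 < t n
  tendsto_zero : Tendsto t atTop (𝓝 0)
  log_isLittleO :
    (fun n : ℕ => Real.log (2 * n + 1)) =o[atTop] fun n : ℕ => (n : ℝ) * t n ^ (2 * k)
  centeredSum_le : ∀ ε : ℝ, 0 < ε → ∀ᶠ n : ℕ in atTop, ∀ x : ℝ, |x| ≤ |m| + 1 →
    |centeredSum ν (fun y => Real.tanh (β * (x + y))) h n| ≤ ε * (n * t n ^ (2 * k - 1))

lemma hasDerivAt_empiricalG_sub_mul_G [IsFiniteMeasure ν] (hν : Integrable (fun x : ℝ => x) ν)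
    (h : ℕ → ℝ) (n : ℕ) (x : ℝ) :
    HasDerivAt (fun y => empiricalG β h n y - n * G β ν y)
      (-(β * centeredSum ν (fun y => Real.tanh (β * (x + y))) h n)) x := by
  have hquad : HasDerivAt (fun y : ℝ => n * (β / 2 * y ^ 2)) (n * (β * x)) x :=
    (((hasDerivAt_pow 2 x).const_mul (β / 2)).congr_deriv (by norm_num; ring)).const_mul (n : ℝ)
  have hterm (i : ℕ) : HasDerivAt (fun y => Real.log (2 * Real.cosh (β * (y + h i))))
      (β * Real.tanh (β * (x + h i))) x := by
    have haff : HasDerivAt (fun y => β * (y + h i)) β x := by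
      simpa using ((hasDerivAt_id x).add_const (h i)).const_mul β
    simp only [log_two_mul_cosh]
    exact (((hasDerivAt_log_cosh _).comp x haff).const_add _).congr_deriv (mul_comm _ _)
  have hsum := HasDerivAt.fun_sum fun i (_ : i ∈ Finset.range n) => hterm i
  refine ((hquad.sub hsum).sub ((hasDerivAt_G hν x).const_mul (n : ℝ))).congr_deriv ?_
  rw [centeredSum_eq, ← Finset.mul_sum, meanMagnetization]
  ring

lemma abs_empiricalG_sub_le [IsFiniteMeasure ν] (hν : Integrable (fun x : ℝ => x) ν) {n : ℕ}
    {R D x : ℝ} (hD : ∀ y : ℝ, |y| ≤ R →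
      |centeredSum ν (fun z => Real.tanh (β * (y + z))) h n| ≤ D)
    (hm : |m| ≤ R) (hx : |x| ≤ R) :
    |empiricalG β h n x - empiricalG β h n m - n * (G β ν x - G β ν m)| ≤
      |β| * D * |x - m| := by
  have hmvt := (convex_Icc (-R) R).norm_image_sub_le_of_norm_hasDerivWithin_le (C := |β| * D)
    (fun y _ => (hasDerivAt_empiricalG_sub_mul_G (β := β) hν h n y).hasDerivWithinAt)
    (fun y hy => by
      rw [norm_neg, norm_mul]
      exact mul_le_mul_of_nonneg_left (hD y (abs_le.2 hy)) (abs_nonneg β))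
    (abs_le.1 hm) (abs_le.1 hx)
  refine (congrArg abs ?_).trans_le hmvt
  ring

lemma abs_div_sub_lt {N S T p δ : ℝ} (hN : 0 < N) (hST : |S - T| < N * δ)
    (hT : |T - N * p| ≤ N * δ) : |S / N - p| < 2 * δ := by
  rw [div_sub' hN.ne', abs_div, abs_of_pos hN, div_lt_iff₀' hN]
  linarith [abs_sub_le S T (N * p)]

lemma pow_mul_le_pow_succ_add_pow_succ {a b : ℝ} (ha : 0 ≤ a) (hb : 0 ≤ b) (p : ℕ) :
    a ^ p * b ≤ a ^ (p + 1) + b ^ (p + 1) := by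
  rcases le_total a b with hab | hba
  · calc a ^ p * b ≤ b ^ p * b := by gcongr
      _ ≤ _ := by rw [← pow_succ]; exact le_add_of_nonneg_left (by positivity)
  · calc a ^ p * b ≤ a ^ p * a := by gcongr
      _ ≤ _ := by rw [← pow_succ]; exact le_add_of_nonneg_right (by positivity)

lemma rateFunction_le_of_abs_le (hI : 0 ≤ rateFunction β k lam 1) {x y : ℝ} (hxy : |x| ≤ |y|) :
    rateFunction β k lam x ≤ rateFunction β k lam y := by
  rw [rateFunction_eq_mul_pow, rateFunction_eq_mul_pow β k lam y,
    ← (even_two_mul k).pow_abs x, ← (even_two_mul k).pow_abs y]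
  gcongr

lemma rateFunction_mul (β : ℝ) (k : ℕ) (lam s x : ℝ) :
    rateFunction β k lam (s * x) = s ^ (2 * k) * rateFunction β k lam x := by
  rw [rateFunction_eq_mul_pow, rateFunction_eq_mul_pow β k lam x]
  ring

lemma HasModerateFluctuations.eventually_abs_empiricalG_sub_le [IsFiniteMeasure ν]
    (hh : HasModerateFluctuations β ν m k h t) (hk : 1 ≤ k)
    (hν : Integrable (fun x : ℝ => x) ν) {ε : ℝ} (hε : 0 < ε) :
    ∀ᶠ n : ℕ in atTop, ∀ x : ℝ, |x| ≤ |m| + 1 →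
      |empiricalG β h n x - empiricalG β h n m - n * (G β ν x - G β ν m)| ≤
        ε * (n * (t n ^ (2 * k) + (x - m) ^ (2 * k))) := by
  filter_upwards [hh.centeredSum_le (ε / (|β| + 1)) (by positivity), hh.eventually_pos]
    with n hdev ht x hx
  have hyoung := pow_mul_le_pow_succ_add_pow_succ ht.le (abs_nonneg (x - m)) (2 * k - 1)
  rw [show 2 * k - 1 + 1 = 2 * k by omega, (even_two_mul k).pow_abs] at hyoung
  calc _ ≤ |β| * (ε / (|β| + 1) * (n * t n ^ (2 * k - 1))) * |x - m| :=
        abs_empiricalG_sub_le hν hdev (by linarith) hx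
    _ = |β| * (ε / (|β| + 1)) * (n * (t n ^ (2 * k - 1) * |x - m|)) := by ring
    _ ≤ ε * (n * (t n ^ (2 * k) + (x - m) ^ (2 * k))) := by
        gcongr
        rw [mul_div_left_comm]
        exact mul_le_of_le_one_right hε.le ((div_le_one (by positivity)).2 (by linarith))

lemma eventually_le_min_rateFunction (ht : Tendsto t atTop (𝓝 0)) (hk : 1 ≤ k)
    (hI : 0 ≤ rateFunction β k lam 1) {κ : ℝ} (hκ : 0 < κ) {c : ℝ} (hc : 0 ≤ c) (y : ℝ) :
    ∀ᶠ n in atTop, ∀ w : ℝ, |t n * y| ≤ |w| →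
      t n ^ (2 * k) * (c * rateFunction β k lam y) ≤ min (c * rateFunction β k lam w) κ := by
  have hzero : Tendsto (fun n => t n ^ (2 * k) * (c * rateFunction β k lam y)) atTop (𝓝 0) := by
    simpa [show k ≠ 0 by omega] using
      (ht.pow (2 * k)).mul_const (c * rateFunction β k lam y)
  filter_upwards [hzero.eventually_le_const hκ] with n hle w hw
  refine le_min ?_ hle
  rw [mul_left_comm, ← rateFunction_mul]
  exact mul_le_mul_of_nonneg_left (rateFunction_le_of_abs_le hI hw) hc

lemma HasModerateFluctuations.tendsto_speed (hh : HasModerateFluctuations β ν m k h t) :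
    Tendsto (fun n : ℕ => (n : ℝ) * t n ^ (2 * k)) atTop atTop := by
  have hlog : Tendsto (fun n : ℕ => Real.log (2 * n + 1)) atTop atTop :=
    Real.tendsto_log_atTop.comp <| tendsto_atTop_add_const_right _ _ <|
      tendsto_natCast_atTop_atTop.const_mul_atTop two_pos
  refine tendsto_atTop_mono' _ ?_ hlog
  filter_upwards [hh.log_isLittleO.def one_pos, hh.eventually_pos] with n hle ht
  rw [one_mul, Real.norm_of_nonneg (by positivity : 0 ≤ n * t n ^ (2 * k))] at hle
  exact (le_abs_self _).trans hle

lemma HasModerateFluctuations.eventually_exp_neg_le_one_sub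
    (hh : HasModerateFluctuations β ν m k h t) (hk : 1 ≤ k) {ρ ε : ℝ} (hρ : 0 < ρ) (hε : 0 < ε) :
    ∀ᶠ n : ℕ in atTop, Real.exp (-(n * t n ^ (2 * k) * ε)) ≤
      1 - 2 * Real.exp (-(n * (t n * ρ) ^ 2 / 2)) := by
  have hexp (c : ℝ) (hc : 0 < c) :
      Tendsto (fun n : ℕ => Real.exp (-(n * t n ^ (2 * k) * c))) atTop (𝓝 0) :=
    Real.tendsto_exp_neg_atTop_nhds_zero.comp (hh.tendsto_speed.atTop_mul_const hc)
  filter_upwards [(hexp ε hε).eventually_le_const (by norm_num : (0 : ℝ) < 1 / 2),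
    (hexp (ρ ^ 2 / 2) (by positivity)).eventually_le_const (by norm_num : (0 : ℝ) < 1 / 4),
    hh.tendsto_zero.eventually_le_const one_pos, hh.eventually_pos] with n hhalf hquarter ht₁ ht
  have hmono : Real.exp (-(n * (t n * ρ) ^ 2 / 2)) ≤
      Real.exp (-(n * t n ^ (2 * k) * (ρ ^ 2 / 2))) := by
    rw [Real.exp_le_exp, neg_le_neg_iff]
    calc n * t n ^ (2 * k) * (ρ ^ 2 / 2) ≤ n * t n ^ 2 * (ρ ^ 2 / 2) := by
          gcongr n * ?_ * _
          exact pow_le_pow_of_le_one ht.le ht₁ (by omega)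
      _ = n * (t n * ρ) ^ 2 / 2 := by ring
  linarith

lemma HasModerateFluctuations.tendsto_field (hh : HasModerateFluctuations β ν m k h t) (c : ℝ) :
    Tendsto (fun n => m + c * t n) atTop (𝓝 m) := by
  simpa using (hh.tendsto_zero.const_mul c).const_add m

lemma HasModerateFluctuations.eventually_abs_field_le (hh : HasModerateFluctuations β ν m k h t)
    (c : ℝ) : ∀ᶠ n in atTop, |m + c * t n| ≤ |m| + 1 :=
  (hh.tendsto_field c).abs.eventually_le_const (lt_add_one _)

variable [IsFiniteMeasure ν] [NeZero ν]

lemma HasModerateFluctuations.eventually_exists_field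
    (hh : HasModerateFluctuations β ν m k h t) (hk : HasTypeStrength β ν m k lam)
    (hm : IsPureCenteredAt β ν m) (hβ : 0 < β) (hν : Integrable (fun x : ℝ => x) ν) (y : ℝ)
    {ε : ℝ} (hε : 0 < ε) :
    ∀ᶠ n : ℕ in atTop, ∀ u : ℝ, |u| ≤ 1 → |t n * y| ≤ |u - m| → ∃ x : ℝ,
      n * (β / 2 * (u - x) ^ 2) - empiricalG β h n x ≤
        -empiricalG β h n m + n * t n ^ (2 * k) * (-rateFunction β k lam y + ε) := by
  have hI₁ := (hk.rateFunction_one_pos hm hβ hν).le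
  have hI : 0 ≤ rateFunction β k lam y := by
    rw [rateFunction_eq_mul_pow]
    exact mul_nonneg hI₁ ((even_two_mul k).pow_nonneg y)
  set I := rateFunction β k lam y
  set δ := min 1 (ε / 2 / (I + 1))
  have hδI : δ * I ≤ ε / 2 := by
    calc δ * I ≤ ε / 2 / (I + 1) * (I + 1) := by gcongr; exacts [min_le_right _ _, by linarith]
      _ = ε / 2 := div_mul_cancel₀ _ (by positivity)
  obtain ⟨η, hη, κ, hκ, hfield⟩ :=
    hk.exists_field hm hβ hν (ε := δ) (lt_min one_pos (by positivity))
  filter_upwards [hh.eventually_abs_empiricalG_sub_le hk.one_le_type hν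
      (lt_min hη (half_pos hε)), hh.eventually_pos,
    eventually_le_min_rateFunction hh.tendsto_zero hk.one_le_type hI₁ hκ
      (sub_nonneg.2 (min_le_left 1 _ : δ ≤ 1)) y] with n hemp ht hmin u hu hyu
  obtain ⟨x, hxm, hx⟩ := hfield u hu
  refine ⟨x, ?_⟩
  have hfluct : min η (ε / 2) * (n * (t n ^ (2 * k) + (x - m) ^ (2 * k))) ≤
      n * (ε / 2 * t n ^ (2 * k) + η * (x - m) ^ (2 * k)) := by
    rw [mul_left_comm, mul_add]
    gcongr
    exacts [min_le_right _ _, (even_two_mul k).pow_nonneg _, min_le_left _ _]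
  have hlower := (neg_le_of_abs_le (hemp x hxm)).trans' (neg_le_neg hfluct)
  have hG := mul_le_mul_of_nonneg_left (hx.trans (neg_le_neg (hmin _ hyu))) (Nat.cast_nonneg' n)
  have hδ := mul_le_mul_of_nonneg_left hδI (by positivity : 0 ≤ n * t n ^ (2 * k))
  linarith

lemma HasModerateFluctuations.eventually_sum_gibbsWeight_le
    (hh : HasModerateFluctuations β ν m k h t) (hk : HasTypeStrength β ν m k lam)
    (hm : IsPureCenteredAt β ν m) (hβ : 0 < β) (hν : Integrable (fun x : ℝ => x) ν) (y : ℝ)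
    {ε : ℝ} (hε : 0 < ε) :
    ∀ᶠ n : ℕ in atTop, ∀ A : Finset (Fin n → ℤˣ),
      (∀ σ ∈ A, |y| ≤ |(magnetization σ / n - m) / t n|) →
      ∑ σ ∈ A, gibbsWeight β h σ ≤ Real.exp (-empiricalG β h n m +
        n * t n ^ (2 * k) * (-rateFunction β k lam y + ε)) := by
  filter_upwards [hh.eventually_exists_field hk hm hβ hν y (half_pos hε),
    hh.log_isLittleO.def (half_pos hε), hh.eventually_pos, eventually_ne_atTop 0]
    with n hfield hlog ht hn A hA
  have hspeed : 0 ≤ n * t n ^ (2 * k) := by positivity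
  rw [Real.norm_of_nonneg hspeed] at hlog
  refine (sum_gibbsWeight_le hn A fun σ hσ => hfield (magnetization σ / n) ?_ ?_).trans ?_
  · rw [abs_div, Nat.abs_cast]
    exact div_le_one_of_le₀ (abs_magnetization_le σ) (Nat.cast_nonneg' n)
  · have hσy := hA σ hσ
    rwa [abs_div, le_div_iff₀' (abs_pos.2 ht.ne'), ← abs_mul] at hσy
  · rw [← Real.exp_log (by positivity : (0 : ℝ) < 2 * n + 1), ← Real.exp_add, Real.exp_le_exp]
    linarith [(le_abs_self _).trans hlog]

lemma HasModerateFluctuations.eventually_abs_sum_tanh_sub_le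
    (hh : HasModerateFluctuations β ν m k h t) (hk : 1 ≤ k) (hm : IsPureCenteredAt β ν m)
    (hβ : 0 < β) (hν : Integrable (fun x : ℝ => x) ν) (y : ℝ) {ρ : ℝ} (hρ : 0 < ρ) :
    ∀ᶠ n : ℕ in atTop,
      |∑ i ∈ Finset.range n, Real.tanh (β * (m + (susceptibility β ν m)⁻¹ * y * t n + h i)) -
        n * (m + t n * y)| ≤ n * (t n * ρ) := by
  have hχ := (susceptibility_pos (ν := ν) hβ m).ne'
  set χ := susceptibility β ν m
  have hmean : (fun n => meanMagnetization β ν (m + χ⁻¹ * y * t n) - (m + t n * y))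
      =o[atTop] t := by
    refine (((hm.meanMagnetization_isLittleO hβ.ne' hν).comp_tendsto
      (hh.tendsto_field (χ⁻¹ * y))).trans_isBigO ?_).congr_left fun n => ?_
    · exact (isBigO_const_mul_self (χ⁻¹ * y) t atTop).congr_left fun n => by simp
    · rw [Function.comp_apply, add_sub_cancel_left, mul_assoc χ⁻¹, mul_inv_cancel_left₀ hχ]
      ring
  filter_upwards [hmean.def (half_pos hρ), hh.eventually_abs_field_le (χ⁻¹ * y),
    hh.centeredSum_le (ρ / 2) (half_pos hρ), hh.tendsto_zero.eventually_le_const one_pos,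
    hh.eventually_pos] with n hmean hfield hdev ht₁ ht
  have hn : (0 : ℝ) ≤ n := Nat.cast_nonneg' n
  have hfluct := hdev _ hfield
  rw [centeredSum_eq, ← meanMagnetization] at hfluct
  rw [Real.norm_eq_abs, Real.norm_of_nonneg ht.le] at hmean
  calc _ ≤ ρ / 2 * (n * t n ^ (2 * k - 1)) + n * (ρ / 2 * t n) := by
        refine (abs_sub_le _ _ _).trans (add_le_add hfluct ?_)
        rw [← mul_sub, abs_mul, Nat.abs_cast]
        gcongr
    _ ≤ ρ / 2 * (n * t n) + n * (ρ / 2 * t n) := by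
        gcongr
        exact pow_le_of_le_one ht.le ht₁ (by omega)
    _ = n * (t n * ρ) := by ring

lemma HasModerateFluctuations.eventually_le_energy
    (hh : HasModerateFluctuations β ν m k h t) (hk : HasTypeStrength β ν m k lam)
    (hm : IsPureCenteredAt β ν m) (hβ : 0 < β) (hν : Integrable (fun x : ℝ => x) ν) (y : ℝ)
    {ε : ℝ} (hε : 0 < ε) :
    ∀ᶠ n : ℕ in atTop,
      -empiricalG β h n m + n * t n ^ (2 * k) * (-rateFunction β k lam y - ε) ≤
        n * (β / 2 * ((1 - (susceptibility β ν m)⁻¹) * (t n * y)) ^ 2) -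
          empiricalG β h n (m + (susceptibility β ν m)⁻¹ * y * t n) := by
  have hty : Tendsto (fun n => t n * y) atTop (𝓝 0) := by
    simpa using hh.tendsto_zero.mul_const y
  have hpow : ((fun w : ℝ => w ^ (2 * k)) ∘ fun n => t n * y) =O[atTop] fun n => t n ^ (2 * k) :=
    (isBigO_const_mul_self (y ^ (2 * k)) (fun n => t n ^ (2 * k)) atTop).congr_left fun n => by
      rw [Function.comp_apply, mul_pow, mul_comm]
  have htilt := ((hk.tiltedG_isLittleO hm hβ hν).comp_tendsto hty).trans_isBigO hpow
  set c := (susceptibility β ν m)⁻¹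
  set η := ε / 2 / (1 + (c * y) ^ (2 * k))
  have hpos : 0 < 1 + (c * y) ^ (2 * k) :=
    add_pos_of_pos_of_nonneg one_pos ((even_two_mul k).pow_nonneg _)
  filter_upwards [htilt.def (half_pos hε), hh.eventually_abs_field_le (c * y),
    hh.eventually_abs_empiricalG_sub_le hk.one_le_type hν (by positivity : 0 < η)]
    with n htilt hfield hemp
  have hfluct : η * (n * (t n ^ (2 * k) + (m + c * y * t n - m) ^ (2 * k))) =
      ε / 2 * (n * t n ^ (2 * k)) := by
    rw [add_sub_cancel_left, mul_pow _ (t n)]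
    simp only [η]
    field_simp
  have hupper := (le_abs_self _).trans (hemp _ hfield)
  rw [Function.comp_apply, rateFunction_mul, show c * (t n * y) = c * y * t n by ring,
    Real.norm_of_nonneg ((even_two_mul k).pow_nonneg (t n))] at htilt
  have htilt' := mul_le_mul_of_nonneg_left (neg_le_of_abs_le htilt) (Nat.cast_nonneg' n)
  linarith

lemma HasModerateFluctuations.eventually_le_sum_gibbsWeight
    (hh : HasModerateFluctuations β ν m k h t) (hk : HasTypeStrength β ν m k lam)
    (hm : IsPureCenteredAt β ν m) (hβ : 0 < β) (hν : Integrable (fun x : ℝ => x) ν) (y : ℝ)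
    {r ε : ℝ} (hr : 0 < r) (hε : 0 < ε) :
    ∀ᶠ n : ℕ in atTop, ∀ A : Finset (Fin n → ℤˣ),
      (∀ σ, |(magnetization σ / n - m) / t n - y| < r → σ ∈ A) →
      Real.exp (-empiricalG β h n m + n * t n ^ (2 * k) * (-rateFunction β k lam y - ε)) ≤
        ∑ σ ∈ A, gibbsWeight β h σ := by
  set c := (susceptibility β ν m)⁻¹
  set B := β * |1 - c| * |y|
  set ρ := min (r / 2) (ε / 3 / (2 * B + 1))
  have hB : 0 ≤ B := by positivity
  have hρ : 0 < ρ := lt_min (half_pos hr) (by positivity)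
  have hρr : 2 * ρ ≤ r := by linarith [min_le_left (r / 2) (ε / 3 / (2 * B + 1))]
  have hBρ : B * (2 * ρ) ≤ ε / 3 := by
    have := (le_div_iff₀ (by positivity)).1 (min_le_right (r / 2) (ε / 3 / (2 * B + 1)))
    linarith
  filter_upwards [hh.eventually_le_energy hk hm hβ hν y (by positivity : 0 < ε / 3),
    hh.eventually_abs_sum_tanh_sub_le hk.one_le_type hm hβ hν y hρ,
    hh.eventually_exp_neg_le_one_sub hk.one_le_type hρ (by positivity : 0 < ε / 3),
    hh.eventually_pos, eventually_gt_atTop 0] with n henergy hmean hmass ht hn A hA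
  have hnear (σ : Fin n → ℤˣ) (hσ : |magnetization σ - ∑ i ∈ Finset.range n,
      Real.tanh (β * (m + c * y * t n + h i))| < n * (t n * ρ)) :
      |magnetization σ / n - (m + t n * y)| < t n * (2 * ρ) :=
    (abs_div_sub_lt (Nat.cast_pos.2 hn) hσ hmean).trans_eq (mul_left_comm _ _ _)
  refine le_trans ?_ (le_sum_gibbsWeight hn.ne' (m + c * y * t n)
    (n * (β / 2 * ((1 - c) * (t n * y)) ^ 2 - t n ^ (2 * k) * (B * (2 * ρ))))
    (mul_pos ht hρ).le A fun σ hσ => ⟨hA σ ?_, ?_⟩)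
  · refine le_trans ?_ (mul_le_mul_of_nonneg_left hmass (Real.exp_pos _).le)
    rw [← Real.exp_add, Real.exp_le_exp]
    have := mul_le_mul_of_nonneg_left hBρ (by positivity : 0 ≤ n * t n ^ (2 * k))
    linarith
  · rw [div_sub' ht.ne', abs_div, abs_of_pos ht, div_lt_iff₀' ht, sub_sub]
    exact (hnear σ hσ).trans_le (by gcongr)
  · gcongr
    exact hk.sub_le_quadratic hm hβ hν ht.le (hnear σ hσ).le

end ModerateScale

section ModerateDeviations

variable {β : ℝ} {ν : Measure ℝ} {m : ℝ} {k : ℕ} {lam : ℝ} {h : ℕ → ℝ} {α : ℝ}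

lemma natCast_mul_rpow_sub_one_pow {n : ℕ} (hn : 0 < n) (α : ℝ) (p : ℕ) :
    (n : ℝ) * ((n : ℝ) ^ (α - 1)) ^ p = (n : ℝ) ^ (1 - p * (1 - α)) := by
  have hn' : (0 : ℝ) < n := Nat.cast_pos.2 hn
  rw [← Real.rpow_mul_natCast hn'.le, show 1 - p * (1 - α) = 1 + (α - 1) * p by ring,
    Real.rpow_add hn', Real.rpow_one]

lemma log_two_mul_add_one_isLittleO_rpow {b : ℝ} (hb : 0 < b) :
    (fun n : ℕ => Real.log (2 * n + 1)) =o[atTop] fun n : ℕ => (n : ℝ) ^ b := by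
  have hlog : (fun n : ℕ => Real.log (2 * n + 1)) =O[atTop] fun n : ℕ => Real.log n := by
    refine IsBigO.of_bound 2 ?_
    filter_upwards [eventually_ge_atTop 3] with n hn
    have hn' : (3 : ℝ) ≤ n := by exact_mod_cast hn
    rw [Real.norm_of_nonneg (Real.log_nonneg (by linarith)),
      Real.norm_of_nonneg (Real.log_nonneg (by linarith))]
    calc Real.log (2 * n + 1) ≤ Real.log ((n : ℝ) ^ 2) :=
          Real.log_le_log (by positivity) (by nlinarith)
      _ = 2 * Real.log n := by rw [Real.log_pow, Nat.cast_ofNat]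
  exact hlog.trans_isLittleO
    ((isLittleO_log_rpow_atTop hb).comp_tendsto tendsto_natCast_atTop_atTop)

lemma hasModerateFluctuations_rpow (hk : 1 ≤ k)
    (hdev : ∀ e : ℝ, 0 < e → ∀ᶠ n : ℕ in atTop, ∀ x : ℝ, |x| ≤ |m| + 1 →
      |centeredSum ν (fun y => Real.tanh (β * (x + y))) h n| ≤ (n : ℝ) ^ (1 / 2 + e))
    (hα : 1 - 1 / (2 * (2 * (k : ℝ) - 1)) < α) (hα₁ : α < 1) :
    HasModerateFluctuations β ν m k h fun n => (n : ℝ) ^ (α - 1) := by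
  have hk' : (1 : ℝ) ≤ k := by exact_mod_cast hk
  have hgap : 0 < 1 / 2 - (2 * (k : ℝ) - 1) * (1 - α) := by
    have hscaled := (lt_div_iff₀ (by linarith)).1 (sub_lt_comm.1 hα)
    linarith
  refine ⟨?_, ?_, ?_, fun ε hε => ?_⟩
  · filter_upwards [eventually_gt_atTop 0] with n hn
    exact Real.rpow_pos_of_pos (Nat.cast_pos.2 hn) _
  · simpa only [neg_sub, Function.comp_def] using
      (tendsto_rpow_neg_atTop (sub_pos.2 hα₁)).comp tendsto_natCast_atTop_atTop
  · refine (log_two_mul_add_one_isLittleO_rpow (b := 1 - (2 * k : ℕ) * (1 - α)) ?_).congr' .rfl ?_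
    · push_cast
      nlinarith [mul_nonneg (sub_nonneg.2 hk') (sub_nonneg.2 hα₁.le)]
    · filter_upwards [eventually_gt_atTop 0] with n hn
      exact (natCast_mul_rpow_sub_one_pow hn α _).symm
  · set e := (1 / 2 - (2 * (k : ℝ) - 1) * (1 - α)) / 2 with he
    have hexp : 1 - (2 * k - 1 : ℕ) * (1 - α) = 1 / 2 + e + e := by
      rw [Nat.cast_sub (by omega)]
      push_cast
      rw [he]
      ring
    have he₀ : 0 < e := half_pos hgap
    filter_upwards [hdev e he₀, ((tendsto_rpow_atTop he₀).comp
      tendsto_natCast_atTop_atTop).eventually_ge_atTop ε⁻¹, eventually_gt_atTop 0]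
      with n hle hlarge hn x hx
    rw [natCast_mul_rpow_sub_one_pow hn, hexp, Real.rpow_add (Nat.cast_pos.2 hn), mul_left_comm]
    exact (hle x hx).trans
      (le_mul_of_one_le_right (by positivity) ((inv_le_iff_one_le_mul₀' hε).1 hlarge))

lemma sub_natCast_mul_div_rpow {n : ℕ} (hn : n ≠ 0) (m α s : ℝ) :
    (s - n * m) / (n : ℝ) ^ α = (s / n - m) / (n : ℝ) ^ (α - 1) := by
  have hn' : (n : ℝ) ≠ 0 := Nat.cast_ne_zero.2 hn
  rw [Real.rpow_sub_one hn']
  field_simp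

lemma tendsto_rateFunction_cocompact (hk : 1 ≤ k) (hI : 0 < rateFunction β k lam 1) :
    Tendsto (rateFunction β k lam) (cocompact ℝ) atTop := by
  have habs : Tendsto (fun x : ℝ => rateFunction β k lam 1 * |x| ^ (2 * k)) (cocompact ℝ) atTop :=
    ((tendsto_pow_atTop (by omega)).comp tendsto_norm_cocompact_atTop).const_mul_atTop hI
  refine habs.congr fun x => ?_
  rw [(even_two_mul k).pow_abs, ← rateFunction_eq_mul_pow]

variable [IsFiniteMeasure ν] [NeZero ν]

lemma HasModerateFluctuations.eventually_scaledMagnetizationLaw_tail_le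
    (hh : HasModerateFluctuations β ν m k h fun n => (n : ℝ) ^ (α - 1))
    (hk : HasTypeStrength β ν m k lam) (hm : IsPureCenteredAt β ν m) (hβ : 0 < β)
    (hν : Integrable (fun x : ℝ => x) ν) (y : ℝ) {ε : ℝ} (hε : 0 < ε) :
    ∀ᶠ n : ℕ in atTop, scaledMagnetizationLaw β h m α n {x | |y| ≤ |x|} ≤
      ENNReal.ofReal
        (Real.exp (n * ((n : ℝ) ^ (α - 1)) ^ (2 * k) * (-rateFunction β k lam y + ε))) := by
  filter_upwards [hh.eventually_sum_gibbsWeight_le hk hm hβ hν y hε, eventually_ne_atTop 0]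
    with n hupper hn
  rw [scaledMagnetizationLaw_apply _ _ _ _ _
    (isClosed_le continuous_const continuous_abs).measurableSet]
  refine ENNReal.ofReal_le_ofReal ((div_le_iff₀ (partitionFunction_pos β h n)).2 ?_)
  refine (hupper _ fun σ hσ => ?_).trans ?_
  · rw [← sub_natCast_mul_div_rpow hn]
    exact (Finset.mem_filter.1 hσ).2
  · rw [add_comm, Real.exp_add]
    gcongr
    exact exp_neg_empiricalG_le_partitionFunction hβ.le hn m

lemma HasModerateFluctuations.eventually_le_scaledMagnetizationLaw_ball
    (hh : HasModerateFluctuations β ν m k h fun n => (n : ℝ) ^ (α - 1))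
    (hk : HasTypeStrength β ν m k lam) (hm : IsPureCenteredAt β ν m) (hβ : 0 < β)
    (hν : Integrable (fun x : ℝ => x) ν) (y : ℝ) {r ε : ℝ} (hr : 0 < r) (hε : 0 < ε) :
    ∀ᶠ n : ℕ in atTop, ENNReal.ofReal
        (Real.exp (n * ((n : ℝ) ^ (α - 1)) ^ (2 * k) * (-rateFunction β k lam y - ε))) ≤
      scaledMagnetizationLaw β h m α n (Metric.ball y r) := by
  filter_upwards [hh.eventually_sum_gibbsWeight_le hk hm hβ hν 0 (half_pos hε),
    hh.eventually_le_sum_gibbsWeight hk hm hβ hν y hr (half_pos hε), eventually_ne_atTop 0]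
    with n hupper hlower hn
  have hZ : partitionFunction β h n ≤ _ := hupper Finset.univ fun σ _ => by
    rw [abs_zero]
    exact abs_nonneg _
  rw [← zero_mul (0 : ℝ), rateFunction_mul, zero_pow (by have := hk.one_le_type; omega),
    zero_mul, neg_zero, zero_add] at hZ
  rw [scaledMagnetizationLaw_apply _ _ _ _ _ measurableSet_ball]
  refine ENNReal.ofReal_le_ofReal ((le_div_iff₀ (partitionFunction_pos β h n)).2 ?_)
  refine (mul_le_mul_of_nonneg_left hZ (Real.exp_pos _).le).trans
    (le_trans ?_ (hlower _ fun σ hσ => ?_))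
  · rw [← Real.exp_add, Real.exp_le_exp]
    linarith
  · simpa only [Finset.mem_filter_univ, sub_natCast_mul_div_rpow hn, Metric.mem_ball,
      Real.dist_eq] using hσ

lemma HasModerateFluctuations.satisfiesLDP
    (hh : HasModerateFluctuations β ν m k h fun n => (n : ℝ) ^ (α - 1))
    (hk : HasTypeStrength β ν m k lam) (hm : IsPureCenteredAt β ν m) (hβ : 0 < β)
    (hν : Integrable (fun x : ℝ => x) ν) :
    SatisfiesLDP (fun n => scaledMagnetizationLaw β h m α n)
      (fun n => (n : ℝ) ^ (1 - 2 * (k : ℝ) * (1 - α)))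
      (fun x => ((rateFunction β k lam x : ℝ) : EReal)) := by
  have hspeed : ∀ᶠ n : ℕ in atTop,
      (n : ℝ) ^ (1 - 2 * (k : ℝ) * (1 - α)) = n * ((n : ℝ) ^ (α - 1)) ^ (2 * k) := by
    filter_upwards [eventually_gt_atTop 0] with n hn
    rw [natCast_mul_rpow_sub_one_pow hn, Nat.cast_mul, Nat.cast_ofNat]
  refine satisfiesLDP_of_tail_of_ball (continuous_rateFunction β k lam)
    (tendsto_rateFunction_cocompact hk.one_le_type (hk.rateFunction_one_pos hm hβ hν)) ?_
    (fun y ε hε => ?_) fun y r ε hr hε => ?_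
  · filter_upwards [eventually_gt_atTop 0] with n hn
    exact Real.rpow_pos_of_pos (Nat.cast_pos.2 hn) _
  · filter_upwards [hh.eventually_scaledMagnetizationLaw_tail_le hk hm hβ hν y hε, hspeed]
      with n htail hn
    rwa [hn]
  · filter_upwards [hh.eventually_le_scaledMagnetizationLaw_ball hk hm hβ hν y hr hε, hspeed]
      with n hball hn
    rwa [hn]

end ModerateDeviations

end RFCW

theorem mainTheorem2_general (β : ℝ) (hβ : 0 < β)
    (ν : Measure ℝ) [IsProbabilityMeasure ν]
    (hν : Integrable (fun x : ℝ => x) ν)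
    (m : ℝ) (hm : RFCW.IsPureCenteredAt β ν m)
    (k : ℕ) (lam : ℝ) (hk : RFCW.HasTypeStrength β ν m k lam) :
    ∀ᵐ h ∂(Measure.infinitePi fun _ : ℕ => ν),
      ∀ α : ℝ, 1 - 1 / (2 * (2 * (k : ℝ) - 1)) < α → α < 1 →
        RFCW.SatisfiesLDP
          (fun n : ℕ => RFCW.scaledMagnetizationLaw β h m α n)
          (fun n : ℕ => (n : ℝ) ^ (1 - 2 * (k : ℝ) * (1 - α)))
          (fun x : ℝ => ((RFCW.rateFunction β k lam x : ℝ) : EReal)) := by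
  obtain ⟨R, hR⟩ := exists_nat_ge (|m| + 1)
  have hlip (x y z : ℝ) : |Real.tanh (β * (x + z)) - Real.tanh (β * (y + z))| ≤ β * |x - y| := by
    refine (RFCW.abs_tanh_sub_tanh_le _ _).trans_eq ?_
    rw [← mul_sub, add_sub_add_right_eq_sub, abs_mul, abs_of_pos hβ]
  filter_upwards [RFCW.ae_eventually_abs_centeredSum_le (ν := ν)
    (fun x => (RFCW.continuous_tanh.comp (by fun_prop)).measurable)
    (fun x z => (Real.abs_tanh_lt_one _).le) hlip R] with h hdev α hα hα₁
  refine (RFCW.hasModerateFluctuations_rpow hk.one_le_type (fun e he => ?_) hα hα₁).satisfiesLDP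
    hk hm hβ hν
  filter_upwards [hdev e he] with n hn x hx
  exact hn x (hx.trans hR)

theorem mainTheorem2 (β : ℝ) (hβ : 0 < β)
    (ν : Measure ℝ) [IsProbabilityMeasure ν]
    (hν : Integrable (fun x : ℝ => x ^ 2) ν)
    (m : ℝ) (hm : RFCW.IsPureCenteredAt β ν m)
    (k : ℕ) (lam : ℝ) (hk : RFCW.HasTypeStrength β ν m k lam) :
    ∀ᵐ h ∂(Measure.infinitePi fun _ : ℕ => ν),
      ∀ α : ℝ, 1 - 1 / (2 * (2 * (k : ℝ) - 1)) < α → α < 1 →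
        RFCW.SatisfiesLDP
          (fun n : ℕ => RFCW.scaledMagnetizationLaw β h m α n)
          (fun n : ℕ => (n : ℝ) ^ (1 - 2 * (k : ℝ) * (1 - α)))
          (fun x : ℝ => ((RFCW.rateFunction β k lam x : ℝ) : EReal)) :=
  mainTheorem2_general β hβ ν
    (((memLp_two_iff_integrable_sq aestronglyMeasurable_id).2 hν).integrable one_le_two)
    m hm k lam hk
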